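/- **Setting.** Let $k\ge 2$, let $f_1,\dots,f_k$ be contracting similitudes of $\mathbb R^d$ with attractor $K$ (the nonempty compact set with $K=\bigcup_i f_i(K)$), and let $Q=[0,1]$ be the attractor of $g_i(x)=\frac{x}{k}+\frac{i-1}{k}$. Let $p=(p_1,\dots,p_k)$ be a probability vector with all $p_i>0$ and $\mu$ the Bernoulli measure on $\Sigma=\{1,\dots,k\}^{\mathbb N}$. Let $\pi_K:\Sigma\to K$, $\pi_Q:\Sigma\to Q$ be the natural projections ($\{\pi_K(w)\}=\bigcap_m K_{w_1\dots w_m}$ with $K_w=f_{w_1}\circ\dots\circ f_{w_m}(K)$, similarly for $\pi_Q$), $\nu=(\pi_K)_*\mu$ and $\lambda=(\pi_Q)_*\mu$ (Lebesgue measure if $p$ is uniform). Assume that $\mu$-almost every $w$ satisfies $\pi_K^{-1}(\pi_K(w))=\{w\}$. Let $T:L^2(K,\nu;\mathbb R^n)\to L^2(Q,\lambda;\mathbb R^n)$ be the isometric isomorphism determined by $f\circ\pi_K=(Tf)\circ\pi_Q$ $\mu$-a.e., and let $\Phi^{-1}$ be the map $\pi_K(w)\mapsto\pi_Q(w)$,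 defined on the full-measure set $K_0$ of the points $\pi_K(w)$ such that $w$ is the only address both of $\pi_K(w)$ and of $\pi_Q(w)$. **Evolutions on $Q$.** Let $\mathbf A$ be the generator of a $C_0$-semigroup $(S(t))_{t\ge0}$ on $L^2(Q,\lambda;\mathbb R^n)$. For $\varepsilon>0$ let $\sigma_\varepsilon\in L^2(Q\times Q,\lambda\times\lambda;\mathbb R^{n\times n})$ (matrices carry the operator norm; scalar kernels are the multiples of the identity) and $(\mathbf A_\varepsilon u)(x)=\int_Q\sigma_\varepsilon(x,y)u(y)\,d\lambda(y)$. Let $X$ be a Banach space that is continuously and densely embedded in $L^2(Q,\lambda;\mathbb R^n)$, with $X\subset\mathcal D(\mathbf A)$. **Uniform stability and consistency.** Assume that there are a dense subspace $\mathcal D_0\subset X$ which is a core for $\mathbf A$, a function $r$ with $r(\varepsilon)\to0$ as $\varepsilon\to0^+$, and $M\ge1$, $\omega\in\mathbb R$ such that for every $\varepsilon>0$ the operator $\mathbf A_\varepsilon$ generates a $C_0$-semigroup $S_\varepsilon$ with $\|S_\varepsilon(t)\|\le Me^{\omega t}$ for all $t\ge0$, and $\|\mathbf A_\varepsilon\varphi-\mathbf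 A\varphi\|_{L^2}\le r(\varepsilon)\|\varphi\|_X$ for all $\varphi\in\mathcal D_0$. **Approximation on $K$.** For $u^0\in X$ put $u(t)=S(t)u^0$, $\tilde u(t)=T^{-1}u(t)$, $\tilde u^0=T^{-1}u^0$. Let $\tilde\sigma_\varepsilon(x,y)=\sigma_\varepsilon(\Phi^{-1}(x),\Phi^{-1}(y))$ on $K_0\times K_0$ and $0$ elsewhere. For $m\ge0$ let $P_m$ be the $L^2(K,\nu;\mathbb R^n)$-orthogonal projector onto the functions that are constant on each cell $K_w$, $|w|=m$; let $$\tilde\sigma^{(\varepsilon)}_{wv}=\frac{1}{\nu(K_w)\nu(K_v)}\int_{K_w\times K_v}\tilde\sigma_\varepsilon\,d(\nu\times\nu),\qquad \tilde\sigma_{\varepsilon,m}=\sum_{|w|=|v|=m}\tilde\sigma^{(\varepsilon)}_{wv}\mathbf 1_{K_w\times K_v},\qquad \delta_{\varepsilon,m}=\|\tilde\sigma_\varepsilon-\tilde\sigma_{\varepsilon,m}\|_{L^2(K\times K,\nu\times\nu)},$$ and let $\tilde u_{\varepsilon,m}(t)=\sum_{|w|=m}u_w(t)\mathbf 1_{K_w}$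 be the Galerkin/IPS approximation, that is, the solution of $$\dot u_w(t)=\sum_{|v|=m}\tilde\sigma^{(\varepsilon)}_{wv}\,u_v(t)\,\nu(K_v)\quad(|w|=m),\qquad \tilde u_{\varepsilon,m}(0)=P_m\tilde u^0 .$$ **Theorem.** Let $T>0$ and $B,R,D\in\mathbb R$. There is a constant $C_T$ (depending on the setting above and on $T,B,R,D$, but not on $u^0$, $\varepsilon$ or $m$) such that the following holds. Let $u^0\in X$ satisfy $\|u^0\|_{L^2}\le R$, and suppose that the reference solution stays bounded in $X$ on $[0,T]$: $u(t)\in X$ and $\|u(t)\|_X\le B\|u^0\|_X$ for all $t\in[0,T]$. Let $\varepsilon>0$ and $m\ge0$ be such that $M=1$, or $\|\tilde\sigma_\varepsilon\|_{L^2(K\times K)}\le D$, or $\delta_{\varepsilon,m}\le D$. Then $\tilde u_{\varepsilon,m}-\tilde u\in C([0,T];L^2(K,\nu))$ and $$\|\tilde u_{\varepsilon,m}-\tilde u\|_{C([0,T];L^2(K,\nu))}\le C_T\Big(r(\varepsilon)\,\|u^0\|_X+\|\tilde u^0-P_m\tilde u^0\|_{L^2(K,\nu)}+\|\tilde\sigma_\varepsilon-\tilde\sigma_{\varepsilon,m}\|_{L^2(K\times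 K,\nu\times\nu)}\Big).$$ In particular, for each fixed $\varepsilon$ the constant can be chosen independent of $m$ (take $D=\|\tilde\sigma_\varepsilon\|$); it can be chosen independent of $\varepsilon$ and $m$ along every family on which the last term stays bounded, in particular in every joint limit in which the right-hand side tends to $0$; and if $M=1$ it is independent of $\varepsilon$ and $m$ without any restriction. -/

import Mathlib

open MeasureTheory Set Filter Topology

noncomputable section

namespace FractalLift

/-! ### Self-similar sets and their symbolic coding -/

/-- The space `Σ = [k]^ℕ` of infinite sequences of symbols. -/
abbrev Seq (k : ℕ) : Type := ℕ → Fin k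

/-- The set `Σ_m` of words of length `m`. -/
abbrev Word (k m : ℕ) : Type := Fin m → Fin k

/-- The prefix of length `m` of a sequence of symbols. -/
def seqPrefix {k : ℕ} (w : Seq k) (m : ℕ) : Word k m := fun i => w i

/-- A finite family of contracting similitudes of `Y`, with its attractor: the nonempty compact set
`carrier` that is the union of its images. -/
structure SelfSimilarSet (k : ℕ) (Y : Type*) [MetricSpace Y] where
  /-- the similitudes -/
  map : Fin k → Y → Y
  /-- the contraction ratios -/
  ratio : Fin k → ℝ
  ratio_pos : ∀ i, 0 < ratio i
  ratio_lt_one : ∀ i, ratio i < 1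
  dist_map : ∀ i x y, dist (map i x) (map i y) = ratio i * dist x y
  /-- the attractor -/
  carrier : Set Y
  isCompact : IsCompact carrier
  nonempty : carrier.Nonempty
  self_similar : carrier = ⋃ i, map i '' carrier

/-- The Bernoulli measure `μ_p` on the sequence space. -/
def bernoulliMeasure {k : ℕ} (p : PMF (Fin k)) : Measure (Seq k) :=
  Measure.infinitePi fun _ : ℕ => p.toMeasure

instance {k : ℕ} (p : PMF (Fin k)) : IsProbabilityMeasure (bernoulliMeasure p) := by
  unfold bernoulliMeasure; infer_instance

namespace SelfSimilarSet

variable {k : ℕ} {Y : Type*} [MetricSpace Y] (K : SelfSimilarSet k Y)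

/-- `f_w = f_{w_1} ∘ ⋯ ∘ f_{w_m}`. -/
def wordMap : (m : ℕ) → Word k m → Y → Y
  | 0, _ => id
  | m + 1, w => wordMap m (Fin.init w) ∘ K.map (w (Fin.last m))

/-- The cell `K_w = f_w(K)`. -/
def cell {m : ℕ} (w : Word k m) : Set Y := K.wordMap m w '' K.carrier

theorem continuous_map (i : Fin k) : Continuous (K.map i) := by
  have : LipschitzWith (Real.toNNReal (K.ratio i)) (K.map i) := by
    refine LipschitzWith.of_dist_le_mul fun x y => ?_
    rw [K.dist_map, Real.coe_toNNReal _ (K.ratio_pos i).le]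
  exact this.continuous

theorem continuous_wordMap {m : ℕ} (w : Word k m) : Continuous (K.wordMap m w) := by
  induction m with
  | zero => exact continuous_id
  | succ m ih => exact (ih (Fin.init w)).comp (K.continuous_map _)

theorem isCompact_cell {m : ℕ} (w : Word k m) : IsCompact (K.cell w) :=
  K.isCompact.image (K.continuous_wordMap w)

theorem cell_succ_subset (w : Seq k) (m : ℕ) :
    K.cell (seqPrefix w (m + 1)) ⊆ K.cell (seqPrefix w m) := by
  rintro _ ⟨x, hx, rfl⟩
  refine ⟨K.map (w m) x, ?_, rfl⟩
  rw [K.self_similar]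
  exact mem_iUnion.2 ⟨w m, x, hx, rfl⟩

/-- All ratios are bounded by one constant below `1`. -/
theorem exists_ratio_bound : ∃ q : ℝ, 0 ≤ q ∧ q < 1 ∧ ∀ i, K.ratio i ≤ q := by
  obtain ⟨q, hq, h⟩ : ∃ q : ℝ, q < 1 ∧ ∀ i, K.ratio i ≤ q := by
    rcases isEmpty_or_nonempty (Fin k) with h | h
    · exact ⟨0, one_pos, fun i => h.elim i⟩
    · obtain ⟨i, hi⟩ := Finite.exists_max K.ratio
      exact ⟨K.ratio i, K.ratio_lt_one i, hi⟩
  exact ⟨max q 0, le_max_right _ _, max_lt hq one_pos, fun i => (h i).trans (le_max_left _ _)⟩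

theorem dist_wordMap_le {q : ℝ} (hq0 : 0 ≤ q) (hq : ∀ i, K.ratio i ≤ q) {m : ℕ} (w : Word k m)
    (x y : Y) : dist (K.wordMap m w x) (K.wordMap m w y) ≤ q ^ m * dist x y := by
  induction m generalizing x y with
  | zero => simp [wordMap]
  | succ m ih =>
    refine (ih (Fin.init w) _ _).trans ?_
    rw [K.dist_map, pow_succ, mul_assoc]
    exact mul_le_mul_of_nonneg_left (mul_le_mul_of_nonneg_right (hq _) dist_nonneg)
      (pow_nonneg hq0 _)

theorem dist_le_of_mem_cell {q : ℝ} (hq0 : 0 ≤ q) (hq : ∀ i, K.ratio i ≤ q) {m : ℕ}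
    (w : Word k m) {x y : Y} (hx : x ∈ K.cell w) (hy : y ∈ K.cell w) :
    dist x y ≤ q ^ m * Metric.diam K.carrier := by
  obtain ⟨x, hx, rfl⟩ := hx
  obtain ⟨y, hy, rfl⟩ := hy
  exact (K.dist_wordMap_le hq0 hq w x y).trans (mul_le_mul_of_nonneg_left
    (Metric.dist_le_diam_of_mem K.isCompact.isBounded hx hy) (pow_nonneg hq0 _))

theorem exists_mem_cells (w : Seq k) : ∃ x, ∀ m, x ∈ K.cell (seqPrefix w m) := by
  obtain ⟨x, hx⟩ := IsCompact.nonempty_iInter_of_sequence_nonempty_isCompact_isClosed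
    (fun m => K.cell (seqPrefix w m)) (K.cell_succ_subset w) (fun m => K.nonempty.image _)
    (K.isCompact_cell _) (fun m => (K.isCompact_cell _).isClosed)
  exact ⟨x, mem_iInter.1 hx⟩

/-- The natural projection `π_K : Σ → K`: `π_K(w)` is the point of `⋂_m K_{w_1 … w_m}`. -/
def coding (w : Seq k) : Y := (K.exists_mem_cells w).choose

theorem coding_mem_cell (w : Seq k) (m : ℕ) : K.coding w ∈ K.cell (seqPrefix w m) :=
  (K.exists_mem_cells w).choose_spec m

theorem tendsto_pow_mul_diam {q : ℝ} (hq0 : 0 ≤ q) (hq1 : q < 1) :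
    Tendsto (fun m : ℕ => q ^ m * Metric.diam K.carrier) atTop (𝓝 0) := by
  simpa using (tendsto_pow_atTop_nhds_zero_of_lt_one hq0 hq1).mul_const (Metric.diam K.carrier)

theorem iInter_cell (w : Seq k) : ⋂ m, K.cell (seqPrefix w m) = {K.coding w} := by
  refine Subset.antisymm (fun x hx => ?_)
    (singleton_subset_iff.2 (mem_iInter.2 (K.coding_mem_cell w)))
  obtain ⟨q, hq0, hq1, hq⟩ := K.exists_ratio_bound
  exact dist_le_zero.1 (ge_of_tendsto' (K.tendsto_pow_mul_diam hq0 hq1) fun m =>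
    K.dist_le_of_mem_cell hq0 hq _ (mem_iInter.1 hx m) (K.coding_mem_cell w m))

theorem continuous_coding : Continuous K.coding := by
  obtain ⟨q, hq0, hq1, hq⟩ := K.exists_ratio_bound
  refine continuous_iff_continuousAt.2 fun w => Metric.tendsto_nhds.2 fun ε hε => ?_
  obtain ⟨m, hm⟩ := ((K.tendsto_pow_mul_diam hq0 hq1).eventually_lt_const hε).exists
  have h : ∀ᶠ v : Seq k in 𝓝 w, ∀ i ∈ Finset.range m, v i = w i := by
    refine (Finset.eventually_all _).2 fun i _ => ?_
    exact (continuous_apply i).continuousAt.eventually_mem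
      (show ({w i} : Set (Fin k)) ∈ 𝓝 (w i) from (isOpen_discrete _).mem_nhds rfl)
  filter_upwards [h] with v hv
  have : seqPrefix v m = seqPrefix w m := funext fun i => hv i (Finset.mem_range.2 i.2)
  exact (K.dist_le_of_mem_cell hq0 hq _ (this ▸ K.coding_mem_cell v m)
    (K.coding_mem_cell w m)).trans_lt hm

/-- The set `N_π` of sequences whose image under the natural projection has another address. -/
def ambiguous : Set (Seq k) := {w | ∃ v, v ≠ w ∧ K.coding v = K.coding w}

variable [MeasurableSpace Y] [BorelSpace Y]

theorem measurable_coding : Measurable K.coding := K.continuous_coding.measurable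

theorem measurableSet_cell {m : ℕ} (w : Word k m) : MeasurableSet (K.cell w) :=
  (K.isCompact_cell w).measurableSet

/-- The self-similar measure `ν_p = (π_K)_* μ_p`, as a measure on the ambient space. -/
def measure (p : PMF (Fin k)) : Measure Y := (bernoulliMeasure p).map K.coding

instance (p : PMF (Fin k)) : IsProbabilityMeasure (K.measure p) :=
  Measure.isProbabilityMeasure_map K.measurable_coding.aemeasurable

theorem measurePreserving_coding (p : PMF (Fin k)) :
    MeasurePreserving K.coding (bernoulliMeasure p) (K.measure p) := ⟨K.measurable_coding, rfl⟩

end SelfSimilarSet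

/-! ### Transport of functions -/

/-- The state space `ℝⁿ`. -/
abbrev Vec (n : ℕ) : Type := EuclideanSpace ℝ (Fin n)

/-- `L²(μ; ℝⁿ)`. -/
abbrev L2 {α : Type*} [MeasurableSpace α] (μ : Measure α) (n : ℕ) : Type _ := Lp (Vec n) 2 μ

namespace SelfSimilarSet

variable {k : ℕ} {Y : Type*} [MetricSpace Y] [MeasurableSpace Y] [BorelSpace Y]
  (K : SelfSimilarSet k Y)

/-- The isometry `U_K f = f ∘ π_K`. -/
def pullback (p : PMF (Fin k)) (n : ℕ) : L2 (K.measure p) n →ₗᵢ[ℝ] L2 (bernoulliMeasure p) n :=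
  Lp.compMeasurePreservingₗᵢ ℝ K.coding (K.measurePreserving_coding p)

theorem pullback_surjective (p : PMF (Fin k)) (n : ℕ) (h : bernoulliMeasure p K.ambiguous = 0) :
    Function.Surjective (K.pullback p n) := by
  intro F
  have hpol : PolishSpace (Fin k) := inferInstance
  have hF := Lp.aestronglyMeasurable F
  set S : Set (Seq k) := (toMeasurable (bernoulliMeasure p) K.ambiguous)ᶜ with hS
  have hSm : MeasurableSet S := (measurableSet_toMeasurable _ _).compl
  have hinj : InjOn K.coding S := by
    intro v hv w hw hvw
    by_contra hne
    exact hw (subset_toMeasurable _ _ ⟨v, hne, hvw⟩)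
  have hemb := K.continuous_coding.continuousOn.measurableEmbedding hSm hinj
  obtain ⟨g, hg, hgF⟩ := hemb.exists_stronglyMeasurable_extend
    (f := fun x : S => hF.mk F x) (hF.stronglyMeasurable_mk.comp_measurable measurable_subtype_coe)
    (fun _ => ⟨0⟩)
  have hae : g ∘ K.coding =ᵐ[bernoulliMeasure p] F := by
    have h1 : ∀ᵐ w ∂(bernoulliMeasure p), w ∈ S := by
      rw [ae_iff]; simpa [hS, measure_toMeasurable] using h
    filter_upwards [h1, hF.ae_eq_mk] with w hw hw2
    rw [hw2]
    exact congrFun hgF ⟨w, hw⟩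
  have hmem : MemLp g 2 (K.measure p) := by
    refine ⟨hg.aestronglyMeasurable, ?_⟩
    rw [← eLpNorm_comp_measurePreserving hg.aestronglyMeasurable (K.measurePreserving_coding p),
      eLpNorm_congr_ae hae]
    exact (Lp.memLp F).2
  refine ⟨hmem.toLp g, Lp.ext ?_⟩
  refine (Lp.coeFn_compMeasurePreserving _ (K.measurePreserving_coding p)).trans ?_
  refine EventuallyEq.trans ?_ hae
  exact (K.measurePreserving_coding p).quasiMeasurePreserving.ae_eq_comp hmem.coeFn_toLp

/-- `U_K` as an isometric isomorphism, when almost every sequence is the only address of its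
image. -/
def pullbackEquiv (p : PMF (Fin k)) (n : ℕ) (h : bernoulliMeasure p K.ambiguous = 0) :
    L2 (K.measure p) n ≃ₗᵢ[ℝ] L2 (bernoulliMeasure p) n :=
  LinearIsometryEquiv.ofSurjective (K.pullback p n) (K.pullback_surjective p n h)

end SelfSimilarSet

/-! ### The model system on the unit interval -/

/-- The system `g_i(x) = x / k + i / k`, `i = 0, …, k - 1`, with attractor `Q = [0, 1]`. -/
def unitSystem (k : ℕ) [k.AtLeastTwo] : SelfSimilarSet k ℝ where
  map i x := x / k + (i : ℕ) / k
  ratio _ := 1 / k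
  ratio_pos _ := by
    have : 0 < k := Nat.pos_of_ne_zero (NeZero.ne k)
    positivity
  ratio_lt_one _ := by
    have : (1 : ℝ) < k := by exact_mod_cast Nat.AtLeastTwo.one_lt
    exact (div_lt_one (by linarith)).2 this
  dist_map i x y := by
    rw [dist_add_right, Real.dist_eq, Real.dist_eq, ← sub_div, abs_div, Nat.abs_cast]
    ring
  carrier := Icc 0 1
  isCompact := isCompact_Icc
  nonempty := ⟨0, by simp⟩
  self_similar := by
    have hk : 0 < k := Nat.pos_of_ne_zero (NeZero.ne k)
    have hk' : (0 : ℝ) < k := by exact_mod_cast hk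
    ext x
    simp only [mem_iUnion, mem_image]
    constructor
    · rintro ⟨h0, h1⟩
      rcases h1.eq_or_lt with rfl | h1
      · refine ⟨⟨k - 1, by omega⟩, 1, by simp, ?_⟩
        rw [← add_div, Nat.cast_sub hk]
        field_simp
        simp
      · have hlt : ⌊(k : ℝ) * x⌋₊ < k := by
          rw [Nat.floor_lt (by positivity)]
          nlinarith
        refine ⟨⟨_, hlt⟩, k * x - ⌊(k : ℝ) * x⌋₊, ⟨?_, ?_⟩, ?_⟩
        · linarith [Nat.floor_le (show 0 ≤ (k : ℝ) * x by positivity)]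
        · linarith [Nat.lt_floor_add_one ((k : ℝ) * x)]
        · field_simp
          simp
    · rintro ⟨i, y, ⟨h0, h1⟩, rfl⟩
      have hi : ((i : ℕ) : ℝ) + 1 ≤ k := by exact_mod_cast i.2
      refine ⟨by positivity, ?_⟩
      rw [← add_div, div_le_one hk']
      linarith

theorem unitSystem_wordMap (k : ℕ) [k.AtLeastTwo] (w : Seq k) (m : ℕ) (x : ℝ) :
    (unitSystem k).wordMap m (seqPrefix w m) x =
      (∑ i ∈ Finset.range m, Real.ofDigitsTerm w i) + ((k : ℝ) ^ m)⁻¹ * x := by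
  have hk : (k : ℝ) ≠ 0 := by exact_mod_cast NeZero.ne k
  induction m generalizing x with
  | zero => simp [SelfSimilarSet.wordMap]
  | succ m ih =>
    refine (ih (x / k + (w m : ℕ) / k)).trans ?_
    rw [Finset.sum_range_succ, Real.ofDigitsTerm]
    field_simp
    ring

/-- The natural projection of the model system is the base-`k` expansion. -/
theorem unitSystem_coding (k : ℕ) [k.AtLeastTwo] (w : Seq k) :
    (unitSystem k).coding w = Real.ofDigits w := by
  have h : Real.ofDigits w ∈ ⋂ m, (unitSystem k).cell (seqPrefix w m) := by
    refine mem_iInter.2 fun m => ⟨Real.ofDigits fun i => w (i + m),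
      ⟨Real.ofDigits_nonneg _, Real.ofDigits_le_one _⟩, ?_⟩
    rw [unitSystem_wordMap, ← Real.ofDigits_eq_sum_add_ofDigits]
  rw [SelfSimilarSet.iInter_cell] at h
  exact h.symm

theorem ofDigits_step {k : ℕ} (w : Seq k) :
    Real.ofDigits w = ((w 0 : ℕ) + Real.ofDigits fun i => w (i + 1)) / k := by
  rw [Real.ofDigits_eq_sum_add_ofDigits w 1]
  simp [Real.ofDigitsTerm]
  ring

theorem eq_zero_of_ofDigits_eq_zero {k : ℕ} [k.AtLeastTwo] (n : ℕ) (w : Seq k)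
    (h : Real.ofDigits w = 0) : (w n : ℕ) = 0 := by
  have hk : (k : ℝ) ≠ 0 := by exact_mod_cast NeZero.ne k
  rw [ofDigits_step, div_eq_zero_iff, or_iff_left hk] at h
  have h1 := Real.ofDigits_nonneg fun i => w (i + 1)
  have h2 : (0 : ℝ) ≤ (w 0 : ℕ) := by positivity
  induction n generalizing w with
  | zero => exact_mod_cast (show ((w 0 : ℕ) : ℝ) = 0 by linarith)
  | succ n ih =>
    have h3 : Real.ofDigits (fun i => w (i + 1)) = 0 := by linarith
    rw [ofDigits_step, div_eq_zero_iff, or_iff_left hk] at h3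
    exact ih (fun i => w (i + 1)) h3 (Real.ofDigits_nonneg _) (by positivity)

theorem add_one_eq_of_ofDigits_eq_one {k : ℕ} [k.AtLeastTwo] (n : ℕ) (w : Seq k)
    (h : Real.ofDigits w = 1) : (w n : ℕ) + 1 = k := by
  have hk : (k : ℝ) ≠ 0 := by exact_mod_cast NeZero.ne k
  rw [ofDigits_step, div_eq_one_iff_eq hk] at h
  have h1 := Real.ofDigits_le_one fun i => w (i + 1)
  have h2 : ((w 0 : ℕ) : ℝ) + 1 ≤ k := by exact_mod_cast (w 0).2
  induction n generalizing w with
  | zero => exact_mod_cast (show ((w 0 : ℕ) : ℝ) + 1 = k by linarith)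
  | succ n ih =>
    have h3 : Real.ofDigits (fun i => w (i + 1)) = 1 := by linarith
    rw [ofDigits_step, div_eq_one_iff_eq hk] at h3
    exact ih (fun i => w (i + 1)) h3 (Real.ofDigits_le_one _) (by exact_mod_cast (w _).2)

theorem eventually_const_of_ofDigits_eq {k : ℕ} [k.AtLeastTwo] {v w : Seq k} {n : ℕ}
    (hn : ∀ i < n, v i = w i) (hlt : v n < w n) (h : Real.ofDigits v = Real.ofDigits w) :
    (∀ j, (v (n + 1 + j) : ℕ) + 1 = k) ∧ ∀ j, (w (n + 1 + j) : ℕ) = 0 := by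
  have hk : (0 : ℝ) < k := by exact_mod_cast Nat.pos_of_ne_zero (NeZero.ne k)
  rw [Real.ofDigits_eq_sum_add_ofDigits v n, Real.ofDigits_eq_sum_add_ofDigits w n,
    Finset.sum_congr rfl (fun i hi => by
      rw [Real.ofDigitsTerm, hn i (Finset.mem_range.1 hi), ← Real.ofDigitsTerm])] at h
  have h' := mul_left_cancel₀ (by positivity) (add_left_cancel h)
  rw [ofDigits_step, ofDigits_step fun i => w (i + n), div_left_inj' hk.ne'] at h'
  simp only [zero_add] at h'
  have h1 := Real.ofDigits_le_one fun i => v (i + 1 + n)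
  have h2 := Real.ofDigits_nonneg fun i => w (i + 1 + n)
  have h3 : ((v n : ℕ) : ℝ) + 1 ≤ (w n : ℕ) := by exact_mod_cast hlt
  constructor
  · intro j
    have := add_one_eq_of_ofDigits_eq_one j (fun i => v (i + 1 + n)) (by linarith)
    rwa [show n + 1 + j = j + 1 + n by ring]
  · intro j
    have := eq_zero_of_ofDigits_eq_zero j (fun i => w (i + 1 + n)) (by linarith)
    rwa [show n + 1 + j = j + 1 + n by ring]

/-- For the model system, almost every sequence is the only address of its image. -/
theorem bernoulli_ambiguous_unitSystem {k : ℕ} [k.AtLeastTwo] (p : PMF (Fin k))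
    (hp : ∀ i, p i ≠ 0) : bernoulliMeasure p (unitSystem k).ambiguous = 0 := by
  have hsub : (unitSystem k).ambiguous ⊆
      ⋃ (n : ℕ) (c : Fin k), {w : Seq k | ∀ j, w (n + 1 + j) = c} := by
    rintro w ⟨v, hne, hvw⟩
    rw [unitSystem_coding, unitSystem_coding] at hvw
    have hex : ∃ n, v n ≠ w n := by
      by_contra! hcon
      exact hne (funext hcon)
    classical
    set n := Nat.find hex
    have hn : ∀ i < n, v i = w i := fun i hi => not_not.1 (Nat.find_min hex hi)
    have hc : ∃ c : ℕ, ∀ j, (w (n + 1 + j) : ℕ) = c := by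
      rcases lt_or_gt_of_ne (Nat.find_spec hex) with hlt | hlt
      · exact ⟨0, (eventually_const_of_ofDigits_eq hn hlt hvw).2⟩
      · refine ⟨k - 1, fun j => ?_⟩
        have := (eventually_const_of_ofDigits_eq (fun i hi => (hn i hi).symm) hlt hvw.symm).1 j
        omega
    obtain ⟨c, hc⟩ := hc
    exact mem_iUnion₂.2 ⟨n, w (n + 1), fun j => Fin.ext ((hc j).trans (hc 0).symm)⟩
  refine measure_mono_null hsub (measure_iUnion_null fun n => measure_iUnion_null fun c => ?_)
  have hlt : p c < 1 := by
    refine lt_of_le_of_ne (p.coe_le_one c) fun h1 => ?_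
    rw [PMF.apply_eq_one_iff] at h1
    have : Nontrivial (Fin k) := Fin.nontrivial_iff_two_le.2 (Nat.AtLeastTwo.prop)
    obtain ⟨b, hb⟩ := exists_ne c
    have : b ∈ p.support := (p.mem_support_iff b).2 (hp b)
    rw [h1] at this
    exact hb this
  refine le_antisymm (ge_of_tendsto' (ENNReal.tendsto_pow_atTop_nhds_zero_of_lt_one hlt)
    fun N => ?_) zero_le
  have hpi : bernoulliMeasure p (((Finset.Ico (n + 1) (n + 1 + N) : Finset ℕ) : Set ℕ).pi
      fun _ => ({c} : Set (Fin k))) = p c ^ N := by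
    rw [bernoulliMeasure, Measure.infinitePi_pi _ (fun i _ => measurableSet_singleton c)]
    simp
  rw [← hpi]
  refine measure_mono fun w hw i hi => ?_
  obtain ⟨j, rfl⟩ := Nat.exists_eq_add_of_le (Finset.mem_Ico.1 hi).1
  exact hw j

/-! ### The transport between `L²(K, ν)` and `L²(Q, λ)` -/

/-- The measure `λ_p` on the unit interval `Q`, which is the Lebesgue measure for uniform `p`. -/
abbrev unitMeasure {k : ℕ} [k.AtLeastTwo] (p : PMF (Fin k)) : Measure ℝ :=
  (unitSystem k).measure p

namespace SelfSimilarSet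

variable {k : ℕ} [k.AtLeastTwo] {Y : Type*} [MetricSpace Y]
  (K : SelfSimilarSet k Y)

/-- The isometric isomorphism `T = U_Q⁻¹ U_K`, characterised by `f ∘ π_K = (T f) ∘ π_Q` almost
everywhere. -/
def transport [MeasurableSpace Y] [BorelSpace Y] (p : PMF (Fin k)) (hp : ∀ i, p i ≠ 0)
    (hK : bernoulliMeasure p K.ambiguous = 0) (n : ℕ) :
    L2 (K.measure p) n ≃ₗᵢ[ℝ] L2 (unitMeasure p) n :=
  (K.pullbackEquiv p n hK).trans
    ((unitSystem k).pullbackEquiv p n (bernoulli_ambiguous_unitSystem p hp)).symm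

/-- The set `K₀` of the points of `K` that come from a sequence which is the only address of its
image both in `K` and in `Q`. -/
def goodSet : Set Y := K.coding '' (K.ambiguous ∪ (unitSystem k).ambiguous)ᶜ

/-- The map `Φ⁻¹`, sending `π_K(w)` to `π_Q(w)`; only its values on `K₀` matter. -/
def phiInv (x : Y) : ℝ := (unitSystem k).coding (Function.invFun K.coding x)

theorem phiInv_coding {w : Seq k} (hw : w ∉ K.ambiguous) :
    K.phiInv (K.coding w) = (unitSystem k).coding w := by
  have h := Function.invFun_eq (f := K.coding) ⟨w, rfl⟩
  unfold phiInv
  by_contra hne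
  exact hw ⟨_, fun h' => hne (congrArg _ h'), h⟩

/-- The lifted kernel: `σ(Φ⁻¹ x, Φ⁻¹ y)` on `K₀ × K₀` and zero elsewhere. -/
def liftKernel {F : Type*} [Zero F] (σ : ℝ × ℝ → F) : Y × Y → F :=
  (K.goodSet ×ˢ K.goodSet).indicator fun z => σ (K.phiInv z.1, K.phiInv z.2)

end SelfSimilarSet

/-! ### Galerkin discretization and the interacting particle system -/

namespace SelfSimilarSet

variable {k : ℕ} {Y : Type*} [MetricSpace Y] [MeasurableSpace Y] [BorelSpace Y]
  (K : SelfSimilarSet k Y) (p : PMF (Fin k)) {n : ℕ}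

/-- The vector-valued indicator `1_{K_w} c`. -/
def cellIndicator {m : ℕ} (w : Word k m) (c : Vec n) : L2 (K.measure p) n :=
  indicatorConstLp 2 (K.measurableSet_cell w) (measure_ne_top _ _) c

/-- The step function `∑_w c_w 1_{K_w}`. -/
def stepFunction {m : ℕ} (c : Word k m → Vec n) : L2 (K.measure p) n :=
  ∑ w, K.cellIndicator p w (c w)

/-- The space `H_m` of step functions on the level-`m` partition. -/
def stepSpace (m n : ℕ) : Submodule ℝ (L2 (K.measure p) n) :=
  Submodule.span ℝ (range fun wj : Word k m × Fin n =>
    K.cellIndicator p wj.1 (EuclideanSpace.single wj.2 (1 : ℝ)))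

instance (m n : ℕ) : FiniteDimensional ℝ (K.stepSpace p m n) :=
  FiniteDimensional.span_of_finite ℝ (finite_range _)

/-- The orthogonal projector `P_m` of `L²(K, ν; ℝⁿ)` onto `H_m`. -/
def stepProj (m : ℕ) : L2 (K.measure p) n →L[ℝ] L2 (K.measure p) n :=
  (K.stepSpace p m n).starProjection

variable {F : Type*} [NormedAddCommGroup F] [NormedSpace ℝ F]

/-- The average of a kernel over `K_w × K_v`. -/
def cellAverage (κ : Y × Y → F) {m : ℕ} (w v : Word k m) : F :=
  ⨍ z in K.cell w ×ˢ K.cell v, κ z ∂((K.measure p).prod (K.measure p))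

/-- The step-kernel approximation of a kernel on the level-`m` partition. -/
def stepKernel (κ : Y × Y → F) (m : ℕ) : Y × Y → F := fun z =>
  ∑ w : Word k m, ∑ v : Word k m,
    (K.cell w ×ˢ K.cell v).indicator (fun _ => K.cellAverage p κ w v) z

/-- The `L²(K × K, ν × ν)` norm of a kernel. -/
def kernelNorm (κ : Y × Y → F) : ℝ :=
  (eLpNorm κ 2 ((K.measure p).prod (K.measure p))).toReal

/-- `U` is the solution on `[0, T]` of the interacting particle system
`u_w' = ∑_v κ_{wv} u_v ν(K_v)`, `|w| = m`, whose weights are the cell averages of `κ`, with initial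
state the projection `P_m u⁰`. -/
structure IsParticleSolution (κ : Y × Y → (Vec n →L[ℝ] Vec n)) (m : ℕ) (T : ℝ)
    (u₀ : L2 (K.measure p) n) (U : ℝ → Word k m → Vec n) : Prop where
  ode : ∀ t ∈ Icc 0 T, ∀ w, HasDerivWithinAt (fun s => U s w)
    (∑ v, (K.measure p).real (K.cell v) • K.cellAverage p κ w v (U t v)) (Icc 0 T) t
  initial : K.stepFunction p (U 0) = K.stepProj p m u₀

end SelfSimilarSet

/-! ### Integral operators -/

section Kernel

variable {α : Type*} [MeasurableSpace α] {μ : Measure α} {n : ℕ}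
  {σ : α × α → (Vec n →L[ℝ] Vec n)}

theorem kernel_aestronglyMeasurable [SFinite μ] (hσ : MemLp σ 2 (μ.prod μ)) (u : L2 μ n) :
    AEStronglyMeasurable (fun z : α × α => σ z (u z.2)) (μ.prod μ) :=
  (ContinuousLinearMap.id ℝ (Vec n →L[ℝ] Vec n)).aestronglyMeasurable_comp₂ hσ.1
    ((Lp.aestronglyMeasurable u).comp_snd)

variable [IsProbabilityMeasure μ]

theorem kernel_integrable (hσ : MemLp σ 2 (μ.prod μ)) (u : L2 μ n) :
    ∀ᵐ x ∂μ, Integrable (fun y => σ (x, y) (u y)) μ := by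
  have h : Integrable (fun z : α × α => σ z (u z.2)) (μ.prod μ) := by
    have h2 := hσ.norm.integrable_mul ((Lp.memLp u).comp_snd μ).norm
    refine h2.mono (kernel_aestronglyMeasurable hσ u) (Eventually.of_forall fun z => ?_)
    simpa using (σ z).le_opNorm (u z.2)
  exact h.prod_right_ae

theorem kernel_eLpNorm_le (hσ : MemLp σ 2 (μ.prod μ)) (u : L2 μ n) :
    eLpNorm (fun x => ∫ y, σ (x, y) (u y) ∂μ) 2 μ ≤
      eLpNorm σ 2 (μ.prod μ) * eLpNorm u 2 μ := by
  have hmeas : AEMeasurable (fun z : α × α => ‖σ z‖ₑ ^ (2 : ℝ)) (μ.prod μ) :=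
    hσ.1.enorm.pow_const _
  have hsec : ∀ᵐ x ∂μ, AEMeasurable (fun y => ‖σ (x, y)‖ₑ) μ := by
    filter_upwards [hσ.1.prodMk_left] with x hx using hx.enorm
  have hpt : ∀ᵐ x ∂μ, ‖∫ y, σ (x, y) (u y) ∂μ‖ₑ ^ (2 : ℝ) ≤
      (∫⁻ y, ‖σ (x, y)‖ₑ ^ (2 : ℝ) ∂μ) * ∫⁻ y, ‖u y‖ₑ ^ (2 : ℝ) ∂μ := by
    filter_upwards [hsec] with x hx
    have h1 : ‖∫ y, σ (x, y) (u y) ∂μ‖ₑ ≤ ∫⁻ y, ‖σ (x, y)‖ₑ * ‖u y‖ₑ ∂μ :=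
      (enorm_integral_le_lintegral_enorm _).trans
        (lintegral_mono fun y => (σ (x, y)).le_opENorm (u y))
    have h2 := ENNReal.lintegral_mul_le_Lp_mul_Lq μ Real.HolderConjugate.two_two hx
      (Lp.aestronglyMeasurable u).enorm
    refine (ENNReal.rpow_le_rpow (h1.trans h2) zero_le_two).trans_eq ?_
    rw [ENNReal.mul_rpow_of_nonneg _ _ zero_le_two, ← ENNReal.rpow_mul, ← ENNReal.rpow_mul]
    norm_num
  have key : ∫⁻ x, ‖∫ y, σ (x, y) (u y) ∂μ‖ₑ ^ (2 : ℝ) ∂μ ≤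
      (∫⁻ z, ‖σ z‖ₑ ^ (2 : ℝ) ∂(μ.prod μ)) * ∫⁻ y, ‖u y‖ₑ ^ (2 : ℝ) ∂μ := by
    refine (lintegral_mono_ae hpt).trans_eq ?_
    rw [lintegral_prod _ hmeas, lintegral_mul_const'' _ hmeas.lintegral_prod_right']
  simp only [eLpNorm_eq_lintegral_rpow_enorm_toReal two_ne_zero ENNReal.ofNat_ne_top,
    ENNReal.toReal_ofNat]
  rw [← ENNReal.mul_rpow_of_nonneg _ _ (by norm_num)]
  exact ENNReal.rpow_le_rpow key (by norm_num)

theorem kernel_memLp (hσ : MemLp σ 2 (μ.prod μ)) (u : L2 μ n) :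
    MemLp (fun x => ∫ y, σ (x, y) (u y) ∂μ) 2 μ :=
  ⟨(kernel_aestronglyMeasurable hσ u).integral_prod_right',
    (kernel_eLpNorm_le hσ u).trans_lt (ENNReal.mul_lt_top hσ.2 (Lp.memLp u).2)⟩

/-- The integral operator `(A u)(x) = ∫ σ(x, y) u(y) dμ(y)` on `L²(μ; ℝⁿ)` with a kernel
`σ ∈ L²(μ × μ)`. -/
def integralOperator (σ : α × α → (Vec n →L[ℝ] Vec n)) (hσ : MemLp σ 2 (μ.prod μ)) :
    L2 μ n →L[ℝ] L2 μ n :=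
  LinearMap.mkContinuous
    { toFun := fun u => (kernel_memLp hσ u).toLp _
      map_add' := fun u v => by
        rw [← MemLp.toLp_add, MemLp.toLp_eq_toLp_iff]
        filter_upwards [kernel_integrable hσ u, kernel_integrable hσ v] with x hu hv
        rw [Pi.add_apply, ← integral_add hu hv]
        refine integral_congr_ae ?_
        filter_upwards [Lp.coeFn_add u v] with y hy
        rw [hy, Pi.add_apply, map_add]
      map_smul' := fun c u => by
        rw [RingHom.id_apply, ← MemLp.toLp_const_smul, MemLp.toLp_eq_toLp_iff]
        refine Eventually.of_forall fun x => ?_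
        rw [Pi.smul_apply, ← integral_smul]
        refine integral_congr_ae ?_
        filter_upwards [Lp.coeFn_smul c u] with y hy
        rw [hy, Pi.smul_apply, map_smul] }
    (eLpNorm σ 2 (μ.prod μ)).toReal fun u => by
      refine (Lp.norm_toLp _ (kernel_memLp hσ u)).trans_le ?_
      rw [Lp.norm_def, ← ENNReal.toReal_mul]
      exact ENNReal.toReal_mono (ENNReal.mul_lt_top hσ.2 (Lp.memLp u).2).ne
        (kernel_eLpNorm_le hσ u)

theorem integralOperator_coeFn (σ : α × α → (Vec n →L[ℝ] Vec n)) (hσ : MemLp σ 2 (μ.prod μ))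
    (u : L2 μ n) : integralOperator σ hσ u =ᵐ[μ] fun x => ∫ y, σ (x, y) (u y) ∂μ :=
  MemLp.coeFn_toLp (kernel_memLp hσ u)

end Kernel

/-! ### Semigroups, regularity spaces, stability and consistency -/

/-- A strongly continuous one-parameter semigroup `(S(t))_{t ≥ 0}` of bounded operators; only the
values at `t ≥ 0` matter. -/
structure C0Semigroup (H : Type*) [NormedAddCommGroup H] [NormedSpace ℝ H] where
  /-- the operators of the semigroup -/
  op : ℝ → H →L[ℝ] H
  op_zero : op 0 = ContinuousLinearMap.id ℝ H
  op_add : ∀ s t, 0 ≤ s → 0 ≤ t → op (s + t) = (op s).comp (op t)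
  tendsto_zero : ∀ x, Tendsto (fun t => op t x) (𝓝[>] 0) (𝓝 x)

section Semigroup

variable {H : Type*} [NormedAddCommGroup H] [NormedSpace ℝ H]

/-- The unbounded operator `A` is the infinitesimal generator of the semigroup `S`: `x` belongs to
the domain of `A` and `A x = y` exactly when `(S(t) x - x) / t → y` as `t → 0⁺`. -/
def C0Semigroup.HasGenerator (S : C0Semigroup H) (A : H →ₗ.[ℝ] H) : Prop :=
  ∀ x y, (x, y) ∈ A.graph ↔ Tendsto (fun t : ℝ => t⁻¹ • (S.op t x - x)) (𝓝[>] 0) (𝓝 y)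

variable {X : Type*} [NormedAddCommGroup X] [NormedSpace ℝ X]

/-- `X`, included in `H` by `ι`, is densely and continuously embedded in `H` and contained in the
domain of `A`. -/
structure IsRegularitySpace (A : H →ₗ.[ℝ] H) (ι : X →L[ℝ] H) : Prop where
  injective : Function.Injective ι
  denseRange : DenseRange ι
  mem_domain : ∀ φ, ι φ ∈ A.domain

/-- Uniform semigroup stability of the bounded operators `Aε ε`, `ε > 0`, and their consistency with
`A`, with rate `r`, on a dense subspace `D₀` of `X` which is a core for `A`. -/
structure StabilityConsistency (A : H →ₗ.[ℝ] H) (Aε : ∀ ε : ℝ, 0 < ε → (H →L[ℝ] H))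
    (ι : X →L[ℝ] H) (D₀ : Submodule ℝ X) (r : ℝ → ℝ) (M ω : ℝ) : Prop where
  dense : Dense (D₀ : Set X)
  core : A.HasCore (D₀.map (ι : X →ₗ[ℝ] H))
  rate : Tendsto r (𝓝[>] 0) (𝓝 0)
  one_le : 1 ≤ M
  stability : ∀ ε (hε : 0 < ε), ∃ Sε : C0Semigroup H,
    Sε.HasGenerator ((Aε ε hε : H →ₗ[ℝ] H).toPMap ⊤) ∧
      ∀ t, 0 ≤ t → ‖Sε.op t‖ ≤ M * Real.exp (ω * t)
  consistency : ∀ ε (hε : 0 < ε), ∀ φ ∈ D₀, ∀ y, (ι φ, y) ∈ A.graph →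
    ‖Aε ε hε (ι φ) - y‖ ≤ r ε * ‖φ‖

/-- The trajectory of `S` issued from `u⁰ ∈ X` stays in `X` on `[0, T]`, with norm at most
`B ‖u⁰‖_X`. -/
def StaysRegular (S : C0Semigroup H) (ι : X →L[ℝ] H) (T B : ℝ) (u₀ : X) : Prop :=
  ∀ t ∈ Icc 0 T, ∃ φ : X, ι φ = S.op t (ι u₀) ∧ ‖φ‖ ≤ B * ‖u₀‖

end Semigroup

end FractalLift

end

open FractalLift

/-! Write τ for the inverse transport, κ for the lifted kernel, Ã for its integral operator on K,
and G for the integral operator of the step kernel. Composition with Φ⁻¹ preserves measure, so Ã τ =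
τ A_ε (`integralOperator_liftKernel`). The particle system is the equation v' = G v, because cells
of one level overlap in null sets. Hence the error e = v - τu satisfies e' = G e + f with f = -(Ã -
G) τu + τ(A_ε u - A u). The first term is at most δ ‖u‖, since an operator norm is bounded by the L²
norm of the kernel. The second is at most r(ε) ‖u‖_X, once consistency has been extended from D₀ to
X through closedness of A (`StabilityConsistency.norm_sub_le`). Duhamel's formula for exp(tG)
(`norm_le_of_perturbed_evolution`) then gives the estimate.

What remains is a bound for exp(tG) on [0, T] that is uniform in ε and m
(`exists_bound_exp_stepKernel`). The key fact is that G is the Galerkin compression P_m Ã P_m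
(`inner_integralOperator_stepKernel`). If M = 1, quasi-contractivity amounts to a one-sided bound on
the quadratic form, which compression preserves. If the kernel is bounded in L², so is ‖G‖ ≤ ‖Ã‖. If
δ is bounded, G is a bounded perturbation of Ã, whose semigroup is conjugate to the stable S_ε. -/

namespace FractalLift

/-! ### Grönwall and Duhamel estimates for bounded generators. -/

section Duhamel

variable {H : Type*} [NormedAddCommGroup H] [NormedSpace ℝ H] [CompleteSpace H]

theorem hasDerivAt_exp_smul_apply (G : H →L[ℝ] H) (x : H) (t : ℝ) :
    HasDerivAt (fun s : ℝ => NormedSpace.exp (s • G) x) (G (NormedSpace.exp (t • G) x)) t := by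
  simpa using (hasDerivAt_exp_smul_const' (𝕂 := ℝ) G t).clm_apply (hasDerivAt_const t x)

/-- A group of operators with bounded generator grows at most exponentially. -/
theorem norm_exp_smul_apply_le (G : H →L[ℝ] H) {c t : ℝ} (hc : ‖G‖ ≤ c) (ht : 0 ≤ t) (x : H) :
    ‖NormedSpace.exp (t • G) x‖ ≤ Real.exp (c * t) * ‖x‖ := by
  have h := norm_le_gronwallBound_of_norm_deriv_right_le (δ := ‖x‖) (K := c) (ε := 0) (a := 0)
    (b := t) (f := fun s : ℝ => NormedSpace.exp (s • G) x)
    (fun s _ => (hasDerivAt_exp_smul_apply G x s).continuousAt.continuousWithinAt)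
    (fun s _ => (hasDerivAt_exp_smul_apply G x s).hasDerivWithinAt)
    (by simp)
    (fun s _ => by
      rw [add_zero]
      exact (G.le_opNorm _).trans (mul_le_mul_of_nonneg_right hc (norm_nonneg _)))
    t ⟨ht, le_rfl⟩
  rwa [gronwallBound_ε0, sub_zero, mul_comm] at h

/-- Grönwall's inequality in integral form. -/
theorem le_mul_exp_of_le_add_integral {T c a : ℝ} (ha : 0 ≤ a) (hc : 0 ≤ c) {g : ℝ → ℝ}
    (hg : Continuous g) (hg0 : ∀ t, 0 ≤ g t)
    (h : ∀ t ∈ Icc 0 T, g t ≤ c + a * ∫ s in (0 : ℝ)..t, g s) :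
    ∀ t ∈ Icc 0 T, g t ≤ c * Real.exp (a * T) := by
  have hd : ∀ t, HasDerivAt (fun t => c + a * ∫ s in (0 : ℝ)..t, g s) (a * g t) t := fun t =>
    ((intervalIntegral.integral_hasDerivAt_right (hg.intervalIntegrable _ _)
      (hg.stronglyMeasurableAtFilter _ _) hg.continuousAt).const_mul a).const_add c
  have hpos : ∀ t, 0 ≤ t → 0 ≤ c + a * ∫ s in (0 : ℝ)..t, g s := fun t ht =>
    add_nonneg hc (mul_nonneg ha (intervalIntegral.integral_nonneg ht fun s _ => hg0 s))
  intro t ht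
  -- Grönwall is applied to the majorant c + a ∫ g, which is differentiable with derivative a g, at
  -- most a times the majorant.
  have := norm_le_gronwallBound_of_norm_deriv_right_le (δ := c) (K := a) (ε := 0) (a := 0) (b := T)
    (f := fun t => c + a * ∫ s in (0 : ℝ)..t, g s)
    (fun s _ => (hd s).continuousAt.continuousWithinAt) (fun s _ => (hd s).hasDerivWithinAt)
    (by simp [abs_of_nonneg hc])
    (fun s hs => by
      rw [add_zero, Real.norm_of_nonneg (mul_nonneg ha (hg0 s)),
        Real.norm_of_nonneg (hpos s hs.1)]
      exact mul_le_mul_of_nonneg_left (h s ⟨hs.1, hs.2.le⟩) ha) t ht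
  rw [gronwallBound_ε0, Real.norm_of_nonneg (hpos t ht.1), sub_zero] at this
  refine (h t ht).trans (this.trans (mul_le_mul_of_nonneg_left (Real.exp_le_exp.2 ?_) hc))
  exact mul_le_mul_of_nonneg_left ht.2 ha

/-- Stability of `e' = G e + f` when `‖f‖ ≤ a ‖e‖ + b`. -/
theorem norm_le_of_perturbed_evolution (G : H →L[ℝ] H) {N T a b : ℝ} (hN : 0 ≤ N) (ha : 0 ≤ a)
    (hb : 0 ≤ b)
    (hG : ∀ t ∈ Icc 0 T, ∀ x, ‖NormedSpace.exp (t • G) x‖ ≤ N * ‖x‖) {e e' : ℝ → H}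
    (hc : ContinuousOn e (Icc 0 T))
    (he : ∀ t ∈ Ico 0 T, HasDerivWithinAt e (e' t) (Ici t) t)
    (hf : ∀ t ∈ Ico 0 T, ‖e' t - G (e t)‖ ≤ a * ‖e t‖ + b) :
    ∀ t ∈ Icc 0 T, ‖e t‖ ≤ N * (‖e 0‖ + b * T) * Real.exp (N * a * T) := by
  intro t ht
  have hT : 0 ≤ T := ht.1.trans ht.2
  -- Extending ‖e‖ by its endpoint values makes it continuous on ℝ, so that its primitive is
  -- differentiable everywhere.
  set g : ℝ → ℝ := IccExtend hT (fun s : Icc 0 T => ‖e s‖) with hg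
  have hgc : Continuous g := (continuousOn_iff_continuous_domRestrict.1 hc).norm.Icc_extend'
  have hge : ∀ s ∈ Icc 0 T, g s = ‖e s‖ := fun s hs => IccExtend_of_mem _ _ hs
  have hg0 : ∀ s, 0 ≤ g s := fun s => norm_nonneg _
  rw [← hge t ht]
  refine le_mul_exp_of_le_add_integral (mul_nonneg hN ha) (by positivity) hgc hg0 ?_ t ht
  intro t ht
  rw [hge t ht]
  have hexp : ∀ s, HasDerivAt (fun s : ℝ => NormedSpace.exp ((t - s) • G))
      (-(NormedSpace.exp ((t - s) • G) * G)) s := by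
    intro s
    simpa [Function.comp_def] using (hasDerivAt_exp_smul_const (𝕂 := ℝ) G (t - s)).scomp s
      ((hasDerivAt_id s).const_sub t)
  have hB : ∀ s, HasDerivAt (fun s => N * ‖e 0‖ + N * (a * (∫ r in (0 : ℝ)..s, g r) + b * s))
      (N * (a * g s + b)) s := fun s => by
    have h1 := (intervalIntegral.integral_hasDerivAt_right (hgc.intervalIntegrable 0 s)
      (hgc.stronglyMeasurableAtFilter _ _) hgc.continuousAt).const_mul a
    simpa using ((h1.add ((hasDerivAt_id s).const_mul b)).const_mul N).const_add (N * ‖e 0‖)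
  -- Duhamel's formula as a differential inequality: exp((t - s)G) e(s) runs from exp(tG) e(0) to
  -- e(t), with right derivative exp((t - s)G)(e' - G e). Comparison with a majorant asks for right
  -- derivatives only and for no integrability of e'.
  have key := image_norm_le_of_norm_deriv_right_le_deriv_boundary (a := 0) (b := t)
    (f := fun s => NormedSpace.exp ((t - s) • G) (e s))
    (f' := fun s => NormedSpace.exp ((t - s) • G) (e' s - G (e s)))
    (ContinuousOn.clm_apply (fun s _ => (hexp s).continuousAt.continuousWithinAt)
      (hc.mono (Icc_subset_Icc_right ht.2)))
    (fun s hs => by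
      have := (hexp s).hasDerivWithinAt.clm_apply (he s ⟨hs.1, hs.2.trans_le ht.2⟩)
      refine this.congr_deriv ?_
      rw [neg_apply, map_sub, neg_add_eq_sub]
      rfl)
    (B := fun s => N * ‖e 0‖ + N * (a * (∫ r in (0 : ℝ)..s, g r) + b * s))
    (by simpa using hG t ht (e 0)) hB
    (fun s hs => by
      have hs' : s ∈ Ico 0 T := ⟨hs.1, hs.2.trans_le ht.2⟩
      refine (hG (t - s) ⟨sub_nonneg.2 hs.2.le, by linarith [hs.1, ht.2]⟩ _).trans ?_
      refine mul_le_mul_of_nonneg_left ?_ hN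
      rw [hge s ⟨hs'.1, hs'.2.le⟩]
      exact hf s hs')
    (right_mem_Icc.2 ht.1)
  simp only [sub_self, zero_smul, NormedSpace.exp_zero, one_apply_eq_self] at key
  refine key.trans ?_
  have : N * (b * t) ≤ N * (b * T) :=
    mul_le_mul_of_nonneg_left (mul_le_mul_of_nonneg_left ht.2 hb) hN
  linarith

end Duhamel

/-! ### Strongly continuous semigroups, their generators, and consistency on all of X. -/

section Semigroup

variable {H : Type*} [NormedAddCommGroup H] [NormedSpace ℝ H]

namespace C0Semigroup

variable (S : C0Semigroup H)

theorem op_zero_apply (x : H) : S.op 0 x = x := by rw [S.op_zero]; rfl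

theorem op_add_apply {s t : ℝ} (hs : 0 ≤ s) (ht : 0 ≤ t) (x : H) :
    S.op (s + t) x = S.op s (S.op t x) := by
  rw [S.op_add s t hs ht]; rfl

theorem tendsto_zero_Ici (x : H) : Tendsto (fun s => S.op s x) (𝓝[≥] 0) (𝓝 x) := by
  rw [← Ioi_insert, nhdsWithin_insert, tendsto_sup]
  refine ⟨?_, S.tendsto_zero x⟩
  rw [tendsto_pure_left]
  intro s hs
  rw [S.op_zero_apply]
  exact mem_of_mem_nhds hs

/-- Otherwise there are t_n → 0 with ‖S(t_n)‖ > n + 1, although S(t_n) x → x for every x; this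
contradicts the uniform boundedness principle. -/
theorem exists_bound_near_zero [CompleteSpace H] :
    ∃ δ > 0, ∃ C, 1 ≤ C ∧ ∀ t ∈ Icc 0 δ, ‖S.op t‖ ≤ C := by
  by_contra! hcon
  have hcon' : ∀ n : ℕ, ∃ t ∈ Icc (0 : ℝ) (1 / ((n : ℝ) + 1)), (n : ℝ) + 1 < ‖S.op t‖ := fun n =>
    hcon _ (by positivity) _ (by simp)
  choose t ht hlt using hcon'
  have htend : Tendsto t atTop (𝓝 0) :=
    squeeze_zero (fun n => (ht n).1) (fun n => (ht n).2) tendsto_one_div_add_atTop_nhds_zero_nat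
  have hpt : ∀ x, Tendsto (fun n => S.op (t n) x) atTop (𝓝 x) := by
    intro x
    exact (S.tendsto_zero_Ici x).comp (tendsto_nhdsWithin_iff.2
      ⟨htend, Eventually.of_forall fun n => (ht n).1⟩)
  obtain ⟨C, hC⟩ := banach_steinhaus (g := fun n => S.op (t n)) fun x => by
    obtain ⟨c, hc⟩ := (hpt x).norm.bddAbove_range
    exact ⟨c, fun n => hc ⟨n, rfl⟩⟩
  obtain ⟨n, hn⟩ := exists_nat_gt C
  linarith [hC n, hlt n]

/-- A strongly continuous semigroup is bounded on bounded time intervals. -/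
theorem exists_bound [CompleteSpace H] (T : ℝ) : ∃ C, 1 ≤ C ∧ ∀ t ∈ Icc 0 T, ‖S.op t‖ ≤ C := by
  obtain ⟨δ, hδ, C, hC1, hC⟩ := S.exists_bound_near_zero
  -- Each further step of length δ costs a factor C by the semigroup law; 1 ≤ C covers times shorter
  -- than δ.
  have hind : ∀ n : ℕ, ∀ t ∈ Icc 0 (n * δ), ‖S.op t‖ ≤ C ^ (n + 1) := by
    intro n
    induction n with
    | zero =>
      intro t ht
      simpa using hC t ⟨ht.1, ht.2.trans (by simpa using hδ.le)⟩
    | succ n ih =>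
      intro t ht
      push_cast at ht
      rcases le_total t δ with h | h
      · exact (hC t ⟨ht.1, h⟩).trans (le_self_pow₀ hC1 (by simp))
      · have h1 := S.op_add δ (t - δ) hδ.le (sub_nonneg.2 h)
        rw [add_sub_cancel] at h1
        rw [h1, pow_succ']
        exact (ContinuousLinearMap.opNorm_comp_le _ _).trans (mul_le_mul (hC δ ⟨hδ.le, le_rfl⟩)
          (ih _ ⟨sub_nonneg.2 h, by linarith [ht.2]⟩) (norm_nonneg _) (by linarith))
  obtain ⟨n, hn⟩ := exists_nat_gt (T / δ)
  refine ⟨C ^ (n + 1), one_le_pow₀ hC1, fun t ht => hind n t ⟨ht.1, ht.2.trans ?_⟩⟩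
  exact ((div_lt_iff₀ hδ).1 hn).le

/-- Continuity at 0 spreads through S(s + h)x - S(s)x = S(s)(S(h)x - x). Taking the smaller of the
two times as s, with the local bound on ‖S(s)‖, handles both sides of t. -/
theorem continuousOn_orbit [CompleteSpace H] (x : H) : ContinuousOn (fun t => S.op t x) (Ici 0) := by
  have hz := S.tendsto_zero_Ici x
  intro t ht
  rw [Metric.continuousWithinAt_iff]
  intro ε hε
  obtain ⟨C, hC1, hC⟩ := S.exists_bound (t + 1)
  have hC0 : 0 < C := by linarith
  rw [Metric.tendsto_nhdsWithin_nhds] at hz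
  obtain ⟨δ, hδ, h⟩ := hz (ε / C) (by positivity)
  have key : ∀ s ≥ 0, ∀ h' ≥ 0, s ≤ t + 1 → h' < δ →
      dist (S.op (s + h') x) (S.op s x) < ε := by
    intro s hs h' hh' hst hlt
    rw [S.op_add_apply hs hh', dist_eq_norm, ← map_sub]
    have h2 := h hh' (by simpa [abs_of_nonneg hh'] using hlt)
    rw [dist_eq_norm] at h2
    refine (((S.op s).le_opNorm _).trans
      (mul_le_mul_of_nonneg_right (hC s ⟨hs, hst⟩) (norm_nonneg _))).trans_lt ?_
    rwa [lt_div_iff₀' hC0] at h2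
  refine ⟨min δ 1, lt_min hδ one_pos, fun s hs hst => ?_⟩
  rw [Real.dist_eq, lt_min_iff, abs_lt, abs_lt] at hst
  rcases le_total s t with hle | hle
  · have := key s hs (t - s) (sub_nonneg.2 hle) (by linarith) (by linarith [hst.1.1])
    rwa [add_sub_cancel, dist_comm] at this
  · have := key t ht (s - t) (sub_nonneg.2 hle) (by linarith) (by linarith [hst.1.2])
    rwa [add_sub_cancel] at this

theorem op_sub_eq {t s : ℝ} (ht : 0 ≤ t) (hs : t ≤ s) (x : H) :
    S.op s x - S.op t x = S.op t (S.op (s - t) x - x) := by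
  rw [map_sub, ← S.op_add_apply ht (sub_nonneg.2 hs), add_sub_cancel]

namespace HasGenerator

variable {S} {A : H →ₗ.[ℝ] H}

/-- Orbits issued from the domain of the generator are differentiable from the right. -/
theorem hasDerivWithinAt (hS : S.HasGenerator A) {x y : H} (h : (x, y) ∈ A.graph) {t : ℝ}
    (ht : 0 ≤ t) : HasDerivWithinAt (fun s => S.op s x) (S.op t y) (Ici t) t := by
  rw [hasDerivWithinAt_iff_tendsto_slope, Ici_sdiff_left]
  have hsub : Tendsto (fun s : ℝ => s - t) (𝓝[>] t) (𝓝[>] 0) := by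
    refine tendsto_nhdsWithin_iff.2 ⟨?_, ?_⟩
    · have : Tendsto (fun s : ℝ => s - t) (𝓝 t) (𝓝 (t - t)) := tendsto_id.sub_const t
      rw [sub_self] at this
      exact this.mono_left nhdsWithin_le_nhds
    · filter_upwards [self_mem_nhdsWithin] with s hs using sub_pos.2 (mem_Ioi.1 hs)
  refine ((((S.op t).continuous.tendsto y).comp ((hS x y).1 h)).comp hsub).congr' ?_
  filter_upwards [self_mem_nhdsWithin] with s hs
  rw [slope_def_module, S.op_sub_eq ht (le_of_lt hs)]
  simp

/-- The domain of the generator is invariant under the semigroup. -/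
theorem op_mem_graph (hS : S.HasGenerator A) {x y : H} (h : (x, y) ∈ A.graph) {t : ℝ}
    (ht : 0 ≤ t) : (S.op t x, S.op t y) ∈ A.graph := by
  rw [hS]
  refine (((S.op t).continuous.tendsto y).comp ((hS x y).1 h)).congr' ?_
  filter_upwards [self_mem_nhdsWithin] with s hs
  have hs' : 0 ≤ s := le_of_lt hs
  rw [Function.comp_apply, map_smul, map_sub, ← S.op_add_apply ht hs', ← S.op_add_apply hs' ht,
    add_comm]

/-- The generator of a strongly continuous semigroup is closed. -/
theorem mem_graph_of_tendsto [CompleteSpace H] (hS : S.HasGenerator A) {x y : ℕ → H} {a b : H}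
    (h : ∀ j, (x j, y j) ∈ A.graph) (hx : Tendsto x atTop (𝓝 a)) (hy : Tendsto y atTop (𝓝 b)) :
    (a, b) ∈ A.graph := by
  rw [hS, Metric.tendsto_nhds]
  intro ε hε
  obtain ⟨C, hC1, hC⟩ := S.exists_bound 1
  have hz := S.tendsto_zero_Ici b
  rw [Metric.tendsto_nhdsWithin_nhds] at hz
  obtain ⟨δ, hδ, hb⟩ := hz (ε / 2) (half_pos hε)
  filter_upwards [Ioo_mem_nhdsGT (lt_min hδ one_pos)] with t ht
  have ht0 : 0 < t := ht.1
  have htδ : t < δ := ht.2.trans_le (min_le_left _ _)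
  have ht1 : t < 1 := ht.2.trans_le (min_le_right _ _)
  -- The mean value inequality for S(s)x_j - s b, whose right derivative is S(s)(y_j - b) + (S(s)b -
  -- b). As j → ∞ the first summand disappears, and the second is below ε/2 on [0, t].
  have hj : ∀ j, ‖S.op t (x j) - x j - t • b‖ ≤ (C * ‖y j - b‖ + ε / 2) * t := by
    intro j
    have := norm_image_sub_le_of_norm_deriv_right_le_segment (a := 0) (b := t)
      (f := fun s => S.op s (x j) - s • b) (f' := fun s => S.op s (y j) - b)
      (C := C * ‖y j - b‖ + ε / 2)
      (((S.continuousOn_orbit (x j)).mono Icc_subset_Ici_self).sub (by fun_prop))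
      (fun s hs => (hS.hasDerivWithinAt (h j) hs.1).sub
        (by simpa using ((hasDerivAt_id s).smul_const b).hasDerivWithinAt))
      (fun s hs => by
        have h1 : S.op s (y j) - b = S.op s (y j - b) + (S.op s b - b) := by
          rw [map_sub]; abel
        rw [h1]
        refine (norm_add_le _ _).trans (add_le_add ?_ ?_)
        · exact ((S.op s).le_opNorm _).trans (mul_le_mul_of_nonneg_right
            (hC s ⟨hs.1, by linarith [hs.2]⟩) (norm_nonneg _))
        · rw [← dist_eq_norm]
          refine (hb hs.1 ?_).le
          rw [Real.dist_eq, sub_zero, abs_of_nonneg hs.1]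
          linarith [hs.2])
      t ⟨ht0.le, le_rfl⟩
    simp only [S.op_zero_apply, zero_smul, sub_zero] at this
    rwa [sub_right_comm] at this
  have hlim : ‖S.op t a - a - t • b‖ ≤ (C * ‖b - b‖ + ε / 2) * t :=
    le_of_tendsto_of_tendsto'
      (((((S.op t).continuous.tendsto a).comp hx).sub hx).sub_const _).norm
      ((((hy.sub_const b).norm.const_mul C).add_const _).mul_const t) hj
  have heq : t⁻¹ • (S.op t a - a) - b = t⁻¹ • (S.op t a - a - t • b) := by
    rw [smul_sub _ _ (t • b), inv_smul_smul₀ ht0.ne']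
  rw [dist_eq_norm, heq, norm_smul, norm_inv, Real.norm_of_nonneg ht0.le, inv_mul_lt_iff₀ ht0]
  refine hlim.trans_lt ?_
  rw [sub_self, norm_zero, mul_zero, zero_add, mul_comm]
  exact mul_lt_mul_of_pos_left (half_lt_self hε) ht0

theorem _root_.LinearMap.mem_graph_toPMap_top_iff (f : H →ₗ[ℝ] H) (x y : H) :
    (x, y) ∈ (f.toPMap ⊤).graph ↔ f x = y := by
  rw [LinearPMap.mem_graph_iff]
  constructor
  · rintro ⟨z, rfl, rfl⟩
    rfl
  · rintro rfl
    exact ⟨⟨x, trivial⟩, rfl, rfl⟩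

/-- A semigroup with bounded generator is the exponential of its generator. -/
theorem op_eq_exp [CompleteSpace H] {G : H →L[ℝ] H}
    (hG : S.HasGenerator ((G : H →ₗ[ℝ] H).toPMap ⊤)) {t : ℝ}
    (ht : 0 ≤ t) (x : H) : S.op t x = NormedSpace.exp (t • G) x := by
  have hgr : ∀ x, (x, G x) ∈ ((G : H →ₗ[ℝ] H).toPMap ⊤).graph := fun x =>
    (LinearMap.mem_graph_toPMap_top_iff _ _ _).2 rfl
  -- The difference of the two orbits starts at 0 and solves e' = G e exactly, because S(s) commutes
  -- with G by invariance of the graph.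
  have := norm_le_of_perturbed_evolution G (N := Real.exp (‖G‖ * t)) (T := t) (a := 0) (b := 0)
    (Real.exp_pos _).le le_rfl le_rfl
    (fun s hs y => (norm_exp_smul_apply_le G le_rfl hs.1 y).trans
      (mul_le_mul_of_nonneg_right (Real.exp_le_exp.2
        (mul_le_mul_of_nonneg_left hs.2 (norm_nonneg _))) (norm_nonneg _)))
    (e := fun s => S.op s x - NormedSpace.exp (s • G) x)
    (e' := fun s => S.op s (G x) - G (NormedSpace.exp (s • G) x))
    (((S.continuousOn_orbit x).mono Icc_subset_Ici_self).sub fun s _ =>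
      (hasDerivAt_exp_smul_apply G x s).continuousAt.continuousWithinAt)
    (fun s hs => (hG.hasDerivWithinAt (hgr x) hs.1).sub
      (hasDerivAt_exp_smul_apply G x s).hasDerivWithinAt)
    (fun s hs => by
      have := (LinearMap.mem_graph_toPMap_top_iff _ _ _).1 (hG.op_mem_graph (hgr x) hs.1)
      rw [ContinuousLinearMap.coe_coe] at this
      simp [← this])
    t ⟨ht, le_rfl⟩
  simpa [S.op_zero_apply, sub_eq_zero] using this

end HasGenerator

end C0Semigroup

/-- Consistency extends from a dense subspace of the regularity space to the whole space. -/
theorem StabilityConsistency.norm_sub_le [CompleteSpace H] {X : Type*} [NormedAddCommGroup X]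
    [NormedSpace ℝ X] {S : C0Semigroup H} {A : H →ₗ.[ℝ] H} (hS : S.HasGenerator A)
    {Aε : ∀ ε : ℝ, 0 < ε → (H →L[ℝ] H)} {ι : X →L[ℝ] H} (hι : IsRegularitySpace A ι)
    {D₀ : Submodule ℝ X} {r : ℝ → ℝ} {M ω : ℝ} (h : StabilityConsistency A Aε ι D₀ r M ω) {ε : ℝ}
    (hε : 0 < ε) (φ : X) {y : H} (hy : (ι φ, y) ∈ A.graph) :
    ‖Aε ε hε (ι φ) - y‖ ≤ r ε * ‖φ‖ := by
  obtain ⟨x, hxD, hx⟩ := mem_closure_iff_seq_limit.1 (h.dense φ)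
  set z : ℕ → H := fun j => A ⟨ι (x j), hι.mem_domain _⟩ with hz
  have hgr : ∀ j, (ι (x j), z j) ∈ A.graph := fun j =>
    LinearPMap.mem_graph A ⟨ι (x j), hι.mem_domain _⟩
  have hAx : Tendsto (fun j => Aε ε hε (ι (x j))) atTop (𝓝 (Aε ε hε (ι φ))) :=
    ((Aε ε hε).continuous.comp ι.continuous).continuousAt.tendsto.comp hx
  -- D₀ is a subspace, so consistency applies to x_i - x_j and makes the consistency errors Cauchy.
  -- As A_ε is bounded, the values A x_j then converge, and closedness of A identifies their limit.
  -- The denominator |r ε| + 1 keeps the threshold positive for every value of r ε.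
  have hw : CauchySeq fun j => Aε ε hε (ι (x j)) - z j := by
    refine Metric.cauchySeq_iff.2 fun η hη => ?_
    obtain ⟨N, hN⟩ := Metric.cauchySeq_iff.1 hx.cauchySeq (η / (|r ε| + 1)) (by positivity)
    refine ⟨N, fun i hi j hj => ?_⟩
    have hsub := h.consistency ε hε (x i - x j) (D₀.sub_mem (hxD i) (hxD j)) (z i - z j) (by
      rw [map_sub]
      exact A.graph.sub_mem (hgr i) (hgr j))
    have hij := hN i hi j hj
    rw [dist_eq_norm, lt_div_iff₀ (by positivity)] at hij
    rw [dist_eq_norm, sub_sub_sub_comm, ← map_sub, ← map_sub]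
    refine (hsub.trans (mul_le_mul_of_nonneg_right ((le_abs_self (r ε)).trans
      (le_add_of_nonneg_right zero_le_one)) (norm_nonneg _))).trans_lt ?_
    rwa [mul_comm]
  obtain ⟨c, hc⟩ := cauchySeq_tendsto_of_complete hw
  obtain ⟨b, hb⟩ : ∃ b, Tendsto z atTop (𝓝 b) :=
    ⟨_, (hAx.sub hc).congr fun j => sub_sub_cancel _ _⟩
  have hgb := hS.mem_graph_of_tendsto hgr ((ι.continuous.tendsto φ).comp hx) hb
  obtain rfl : y = b := LinearPMap.mem_graph_snd_inj' A hy hgb rfl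
  exact le_of_tendsto_of_tendsto' (hAx.sub hb).norm (hx.norm.const_mul _) fun j =>
    h.consistency ε hε _ (hxD j) _ (hgr j)

end Semigroup

/-! ### Quasi-contractivity as a one-sided bound on the quadratic form. -/

section Dissipative

variable {H : Type*} [NormedAddCommGroup H] [InnerProductSpace ℝ H] [CompleteSpace H]

open scoped InnerProductSpace

/-- The generator of a quasi-contractive semigroup is quasi-dissipative. -/
theorem inner_le_of_norm_exp_le {G : H →L[ℝ] H} {ω : ℝ} {x : H}
    (h : ∀ t, 0 ≤ t → ‖NormedSpace.exp (t • G) x‖ ≤ Real.exp (ω * t) * ‖x‖) :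
    ⟪x, G x⟫_ℝ ≤ ω * ‖x‖ ^ 2 := by
  -- The function (e^{ωt}‖x‖)² - ‖exp(tG)x‖² vanishes at 0 and is nonnegative for t ≥ 0, so its
  -- derivative 2ω‖x‖² - 2⟨x, Gx⟩ at 0 is nonnegative.
  have hd := ((((hasDerivAt_id (0 : ℝ)).const_mul ω).exp.mul_const ‖x‖).pow 2).sub
    (hasDerivAt_exp_smul_apply G x 0).norm_sq
  have hd' := (hasDerivWithinAt_iff_tendsto_slope' self_notMem_Ioi).1
    (hd.hasDerivWithinAt (s := Ioi 0))
  have h0 := ge_of_tendsto hd' (b := 0) (by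
    filter_upwards [self_mem_nhdsWithin] with t ht
    have ht' : 0 ≤ t := le_of_lt ht
    rw [slope_def_field]
    refine div_nonneg ?_ (by simpa using ht')
    have := pow_le_pow_left₀ (norm_nonneg _) (h t ht') 2
    simpa using this)
  simp at h0
  nlinarith [h0]

/-- The exponential of a quasi-dissipative bounded operator is quasi-contractive. -/
theorem norm_exp_smul_apply_le_of_inner_le {G : H →L[ℝ] H} {ω : ℝ}
    (h : ∀ x, ⟪x, G x⟫_ℝ ≤ ω * ‖x‖ ^ 2) {t : ℝ} (ht : 0 ≤ t) (x : H) :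
    ‖NormedSpace.exp (t • G) x‖ ≤ Real.exp (ω * t) * ‖x‖ := by
  have hd : ∀ s : ℝ, HasDerivAt
      (fun s : ℝ => Real.exp (-(2 * ω) * s) * ‖NormedSpace.exp (s • G) x‖ ^ 2)
      (Real.exp (-(2 * ω) * s) * (2 * (⟪NormedSpace.exp (s • G) x, G (NormedSpace.exp (s • G) x)⟫_ℝ
        - ω * ‖NormedSpace.exp (s • G) x‖ ^ 2))) s := by
    intro s
    refine (((hasDerivAt_id s).const_mul (-(2 * ω))).exp.mul
      (hasDerivAt_exp_smul_apply G x s).norm_sq).congr_deriv ?_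
    simp only [id]
    ring
  have hanti := antitone_of_deriv_nonpos (fun s => (hd s).differentiableAt) fun s => by
    rw [(hd s).deriv]
    exact mul_nonpos_of_nonneg_of_nonpos (Real.exp_pos _).le
      (by linarith [h (NormedSpace.exp (s • G) x)])
  have h1 := hanti ht
  simp only [mul_zero, Real.exp_zero, zero_smul, NormedSpace.exp_zero, one_apply_eq_self,
    one_mul] at h1
  refine le_of_sq_le_sq ?_ (by positivity)
  rw [mul_pow, ← Real.exp_nat_mul]
  rw [show -(2 * ω) * t = -((2 : ℕ) * (ω * t)) by push_cast; ring, Real.exp_neg,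
    inv_mul_le_iff₀ (Real.exp_pos _)] at h1
  exact h1

end Dissipative

/-! ### Addresses, cells, and the lift from Q to K. -/

theorem SelfSimilarSet.liftKernel_ae_eq {k : ℕ} [k.AtLeastTwo] {Y : Type*} [MetricSpace Y]
    [MeasurableSpace Y] (K : SelfSimilarSet k Y) {F : Type*} [Zero F]
    {p : PMF (Fin k)} {Ψ : Y → ℝ}
    (h : ∀ᵐ x ∂K.measure p, x ∈ K.goodSet ∧ K.phiInv x = Ψ x) (σ : ℝ × ℝ → F) :
    K.liftKernel σ =ᵐ[(K.measure p).prod (K.measure p)] σ ∘ Prod.map Ψ Ψ := by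
  filter_upwards [Measure.quasiMeasurePreserving_fst.ae h,
    Measure.quasiMeasurePreserving_snd.ae h] with z h1 h2
  rw [liftKernel, indicator_of_mem (mk_mem_prod h1.1 h2.1), h1.2, h2.2]
  rfl

namespace SelfSimilarSet

section Cells

variable {k : ℕ} {Y : Type*} [MetricSpace Y] (K : SelfSimilarSet k Y)

/-- Self-similarity supplies one more symbol at a time; overwriting position m + j leaves the
earlier ones alone. -/
theorem exists_seqPrefix_eq_of_mem_cell [NeZero k] {m : ℕ} {v : Word k m} {x : Y}
    (hx : x ∈ K.cell v) (j : ℕ) :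
    ∃ z : Seq k, seqPrefix z m = v ∧ x ∈ K.cell (seqPrefix z (m + j)) := by
  induction j with
  | zero =>
    have h : seqPrefix (fun i => if h : i < m then v ⟨i, h⟩ else 0) m = v :=
      funext fun i => by simp [seqPrefix]
    exact ⟨_, h, by rw [add_zero, h]; exact hx⟩
  | succ j ih =>
    obtain ⟨z, hz, y, hy, rfl⟩ := ih
    rw [K.self_similar] at hy
    obtain ⟨i, y', hy', rfl⟩ := mem_iUnion.1 hy
    have hne : ∀ i' < m + j, Function.update z (m + j) i i' = z i' := fun i' hi' =>
      Function.update_of_ne hi'.ne _ _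
    refine ⟨Function.update z (m + j) i, ?_, y', hy', ?_⟩
    · rw [← hz]
      exact funext fun i' => hne _ (by omega)
    · have h1 : Fin.init (seqPrefix (Function.update z (m + j) i) (m + j + 1)) =
          seqPrefix z (m + j) := funext fun i' => hne _ i'.2
      have h2 : seqPrefix (Function.update z (m + j) i) (m + j + 1) (Fin.last _) = i := by
        simp [seqPrefix]
      change K.wordMap (m + j) (Fin.init (seqPrefix (Function.update z (m + j) i) (m + j + 1)))
        (K.map (seqPrefix (Function.update z (m + j) i) (m + j + 1) (Fin.last _)) y') = _
      rw [h1, h2]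

/-- The points of a cell have an address that starts with the word of the cell. -/
theorem cell_subset_coding_image [NeZero k] {m : ℕ} (v : Word k m) :
    K.cell v ⊆ K.coding '' {z | seqPrefix z m = v} := by
  intro x hx
  have hcl : IsClosed (K.coding '' {z : Seq k | seqPrefix z m = v}) := by
    have : IsClosed {z : Seq k | seqPrefix z m = v} := by
      refine isClosed_eq (continuous_pi fun i => continuous_apply _) continuous_const
    exact (this.isCompact.image K.continuous_coding).isClosed
  obtain ⟨q, hq0, hq1, hq⟩ := K.exists_ratio_bound
  -- The image of a cylinder is closed, so it suffices to approximate x by coded points that share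
  -- ever deeper cells with it; no limiting address has to be constructed.
  rw [← hcl.closure_eq, Metric.mem_closure_iff]
  intro ε hε
  obtain ⟨N, hN⟩ := eventually_atTop.1 ((K.tendsto_pow_mul_diam hq0 hq1).eventually_lt_const hε)
  obtain ⟨z, hz, hxz⟩ := K.exists_seqPrefix_eq_of_mem_cell hx N
  exact ⟨_, ⟨z, hz, rfl⟩, (K.dist_le_of_mem_cell hq0 hq _ hxz (K.coding_mem_cell z _)).trans_lt
    (hN _ (Nat.le_add_left _ _))⟩

/-- A point of the cell of v has an address beginning with v, and w is its only address. -/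
theorem coding_mem_cell_iff [NeZero k] {w : Seq k} (hw : w ∉ K.ambiguous) {m : ℕ}
    (v : Word k m) : K.coding w ∈ K.cell v ↔ seqPrefix w m = v := by
  constructor
  · intro h
    obtain ⟨z, hz, hzw⟩ := K.cell_subset_coding_image v h
    obtain rfl : z = w := by
      by_contra hne
      exact hw ⟨z, hne, hzw⟩
    exact hz
  · rintro rfl
    exact K.coding_mem_cell w m

/-- Different cells of the same level overlap in a null set. -/
theorem measure_cell_inter_cell [NeZero k] [MeasurableSpace Y] [BorelSpace Y] {p : PMF (Fin k)}
    (hK : bernoulliMeasure p K.ambiguous = 0) {m : ℕ} {v w : Word k m} (hvw : v ≠ w) :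
    K.measure p (K.cell v ∩ K.cell w) = 0 := by
  rw [measure, Measure.map_apply K.measurable_coding
    ((K.measurableSet_cell v).inter (K.measurableSet_cell w))]
  refine measure_mono_null (fun z hz => ?_) hK
  by_contra hcon
  exact hvw (((K.coding_mem_cell_iff hcon v).1 hz.1).symm.trans
    ((K.coding_mem_cell_iff hcon w).1 hz.2))

end Cells

section Lift

variable {k : ℕ} [k.AtLeastTwo] {Y : Type*} [MetricSpace Y] [MeasurableSpace Y] [BorelSpace Y]
  (K : SelfSimilarSet k Y)

/-- The map `Φ⁻¹` agrees almost everywhere with a measure preserving map. -/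
theorem exists_measurePreserving_phiInv (p : PMF (Fin k)) (hp : ∀ i, p i ≠ 0)
    (hK : bernoulliMeasure p K.ambiguous = 0) :
    ∃ Ψ : Y → ℝ, MeasurePreserving Ψ (K.measure p) (unitMeasure p) ∧
      (∀ᵐ w ∂bernoulliMeasure p, Ψ (K.coding w) = (unitSystem k).coding w) ∧
      ∀ᵐ x ∂K.measure p, x ∈ K.goodSet ∧ K.phiInv x = Ψ x := by
  have hpol : PolishSpace (Fin k) := inferInstance
  have hnull : bernoulliMeasure p (K.ambiguous ∪ (unitSystem k).ambiguous) = 0 :=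
    measure_union_null hK (bernoulli_ambiguous_unitSystem p hp)
  -- Removing a measurable null hull of the ambiguous sequences leaves a Borel set on which the
  -- coding is continuous and injective, hence a measurable embedding. Thus π_Q ∘ π_K⁻¹ on its image
  -- extends to a measurable Ψ, while `phiInv` itself is defined by a choice of preimages.
  set S : Set (Seq k) := (toMeasurable (bernoulliMeasure p)
    (K.ambiguous ∪ (unitSystem k).ambiguous))ᶜ with hS
  have hSm : MeasurableSet S := (measurableSet_toMeasurable _ _).compl
  have hSsub : ∀ w ∈ S, w ∉ K.ambiguous ∪ (unitSystem k).ambiguous := fun w hw hw' =>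
    hw (subset_toMeasurable _ _ hw')
  have hSae : ∀ᵐ w ∂bernoulliMeasure p, w ∈ S := by
    rw [ae_iff]; simpa [hS, measure_toMeasurable] using hnull
  have hinj : InjOn K.coding S := by
    intro v hv w hw hvw
    by_contra hne
    exact hSsub w hw (Or.inl ⟨v, hne, hvw⟩)
  have hemb := K.continuous_coding.continuousOn.measurableEmbedding hSm hinj
  obtain ⟨Ψ, hΨ, hΨS⟩ := hemb.exists_measurable_extend
    (g := fun w : S => (unitSystem k).coding w)
    ((unitSystem k).measurable_coding.comp measurable_subtype_coe) fun _ => ⟨0⟩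
  have hΨw : ∀ w ∈ S, Ψ (K.coding w) = (unitSystem k).coding w := fun w hw =>
    congrFun hΨS ⟨w, hw⟩
  have hΨae := hSae.mono hΨw
  refine ⟨Ψ, ⟨hΨ, ?_⟩, hΨae, ?_⟩
  · rw [measure, Measure.map_map hΨ K.measurable_coding]
    exact Measure.map_congr hΨae
  · have him : MeasurableSet (K.coding '' S) := by
      have := hemb.measurableSet_range
      rwa [range_domRestrict] at this
    have hae : ∀ᵐ x ∂K.measure p, x ∈ K.coding '' S := by
      refine (ae_map_iff (p := (· ∈ K.coding '' S)) K.measurable_coding.aemeasurable him).2 ?_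
      exact hSae.mono fun w hw => ⟨w, hw, rfl⟩
    filter_upwards [hae]
    rintro _ ⟨w, hw, rfl⟩
    refine ⟨⟨w, hSsub w hw, rfl⟩, ?_⟩
    rw [hΨw w hw, K.phiInv_coding fun h => hSsub w hw (Or.inl h)]

/-- The inverse of the transport is the composition with `Φ⁻¹`. -/
theorem transport_symm_eq {p : PMF (Fin k)} (hp : ∀ i, p i ≠ 0)
    (hK : bernoulliMeasure p K.ambiguous = 0) {n : ℕ} {Ψ : Y → ℝ}
    (hΨ : MeasurePreserving Ψ (K.measure p) (unitMeasure p))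
    (h : ∀ᵐ w ∂bernoulliMeasure p, Ψ (K.coding w) = (unitSystem k).coding w)
    (u : L2 (unitMeasure p) n) :
    (K.transport p hp hK n).symm u = Lp.compMeasurePreserving Ψ hΨ u := by
  change (K.pullbackEquiv p n hK).symm ((unitSystem k).pullback p n u) = _
  rw [LinearIsometryEquiv.symm_apply_eq]
  change Lp.compMeasurePreserving _ ((unitSystem k).measurePreserving_coding p) u =
    Lp.compMeasurePreserving _ (K.measurePreserving_coding p) (Lp.compMeasurePreserving Ψ hΨ u)
  refine Lp.ext ?_
  have h1 := Lp.coeFn_compMeasurePreserving u ((unitSystem k).measurePreserving_coding p)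
  have h2 := Lp.coeFn_compMeasurePreserving (Lp.compMeasurePreserving Ψ hΨ u)
    (K.measurePreserving_coding p)
  have h3 := (K.measurePreserving_coding p).quasiMeasurePreserving.ae_eq_comp
    (Lp.coeFn_compMeasurePreserving u hΨ)
  filter_upwards [h, h1, h2, h3] with w hw h1 h2 h3
  rw [h1, h2, h3, Function.comp_apply, Function.comp_apply, Function.comp_apply, hw]

theorem liftKernel_memLp {F : Type*} [NormedAddCommGroup F] {p : PMF (Fin k)} (hp : ∀ i, p i ≠ 0)
    (hK : bernoulliMeasure p K.ambiguous = 0) {σ : ℝ × ℝ → F}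
    (hσ : MemLp σ 2 ((unitMeasure p).prod (unitMeasure p))) :
    MemLp (K.liftKernel σ) 2 ((K.measure p).prod (K.measure p)) := by
  obtain ⟨Ψ, hΨ, -, hgood⟩ := K.exists_measurePreserving_phiInv p hp hK
  exact (memLp_congr_ae (K.liftKernel_ae_eq hgood σ)).2 (hσ.comp_measurePreserving (hΨ.prod hΨ))

end Lift

end SelfSimilarSet

/-! ### Integral operators: dependence on the kernel and change of variables. -/

theorem _root_.MeasureTheory.MeasurePreserving.integral_comp_of_aestronglyMeasurable
    {α β E : Type*} [MeasurableSpace α] [MeasurableSpace β] [NormedAddCommGroup E]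
    [NormedSpace ℝ E] {μ : Measure α} {ν : Measure β} {Ψ : β → α} (hΨ : MeasurePreserving Ψ ν μ)
    {f : α → E} (hf : AEStronglyMeasurable f μ) : ∫ y, f (Ψ y) ∂ν = ∫ x, f x ∂μ := by
  rw [← hΨ.map_eq] at hf ⊢
  exact (integral_map hΨ.measurable.aemeasurable hf).symm

section Kernel

variable {α : Type*} [MeasurableSpace α] {μ : Measure α} [IsProbabilityMeasure μ] {n : ℕ}
  {σ τ : α × α → (Vec n →L[ℝ] Vec n)}

theorem norm_integralOperator_le (hσ : MemLp σ 2 (μ.prod μ)) :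
    ‖integralOperator σ hσ‖ ≤ (eLpNorm σ 2 (μ.prod μ)).toReal :=
  LinearMap.mkContinuous_norm_le _ ENNReal.toReal_nonneg _

theorem integralOperator_sub (hσ : MemLp σ 2 (μ.prod μ)) (hτ : MemLp τ 2 (μ.prod μ)) :
    integralOperator (σ - τ) (hσ.sub hτ) = integralOperator σ hσ - integralOperator τ hτ := by
  ext1 u
  refine Lp.ext ?_
  rw [sub_apply]
  filter_upwards [integralOperator_coeFn _ (hσ.sub hτ) u, integralOperator_coeFn _ hσ u,
    integralOperator_coeFn _ hτ u, Lp.coeFn_sub (integralOperator σ hσ u) (integralOperator τ hτ u),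
    kernel_integrable hσ u, kernel_integrable hτ u] with x h1 h2 h3 h4 h5 h6
  rw [h1, h4, Pi.sub_apply, h2, h3, ← integral_sub h5 h6]
  rfl

theorem integralOperator_congr_ae (hσ : MemLp σ 2 (μ.prod μ)) (hτ : MemLp τ 2 (μ.prod μ))
    (h : σ =ᵐ[μ.prod μ] τ) : integralOperator σ hσ = integralOperator τ hτ := by
  ext1 u
  refine Lp.ext ?_
  filter_upwards [integralOperator_coeFn _ hσ u, integralOperator_coeFn _ hτ u,
    Measure.ae_ae_of_ae_prod h] with x h1 h2 h3
  rw [h1, h2]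
  refine integral_congr_ae ?_
  filter_upwards [h3] with y hy
  rw [hy]

/-- Integral operators are intertwined by the composition with a measure preserving map. -/
theorem integralOperator_compMeasurePreserving {β : Type*} [MeasurableSpace β] {ν : Measure β}
    [IsProbabilityMeasure ν] {Ψ : β → α} (hΨ : MeasurePreserving Ψ ν μ)
    (hσ : MemLp σ 2 (μ.prod μ)) (u : L2 μ n) :
    integralOperator (σ ∘ Prod.map Ψ Ψ) (hσ.comp_measurePreserving (hΨ.prod hΨ))
      (Lp.compMeasurePreserving Ψ hΨ u) =
        Lp.compMeasurePreserving Ψ hΨ (integralOperator σ hσ u) := by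
  refine Lp.ext ?_
  have h1 := integralOperator_coeFn _ (hσ.comp_measurePreserving (hΨ.prod hΨ))
    (Lp.compMeasurePreserving Ψ hΨ u)
  have h2 := Lp.coeFn_compMeasurePreserving (integralOperator σ hσ u) hΨ
  have h3 := hΨ.quasiMeasurePreserving.ae (integralOperator_coeFn _ hσ u)
  have h4 := hΨ.quasiMeasurePreserving.ae (kernel_integrable hσ u)
  filter_upwards [h1, h2, h3, h4] with x h1 h2 h3 h4
  rw [h1, h2, Function.comp_apply, h3]
  rw [← hΨ.integral_comp_of_aestronglyMeasurable h4.1]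
  refine integral_congr_ae ?_
  filter_upwards [Lp.coeFn_compMeasurePreserving u hΨ] with y hy
  rw [hy]
  rfl

end Kernel

/-- The operator of the lifted kernel is conjugate to the original one. -/
theorem SelfSimilarSet.integralOperator_liftKernel {k : ℕ} [k.AtLeastTwo] {Y : Type*}
    [MetricSpace Y] [MeasurableSpace Y] [BorelSpace Y] (K : SelfSimilarSet k Y) {p : PMF (Fin k)}
    (hp : ∀ i, p i ≠ 0) (hK : bernoulliMeasure p K.ambiguous = 0) {n : ℕ}
    {σ : ℝ × ℝ → (Vec n →L[ℝ] Vec n)} (hσ : MemLp σ 2 ((unitMeasure p).prod (unitMeasure p)))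
    (u : L2 (unitMeasure p) n) :
    integralOperator (K.liftKernel σ) (K.liftKernel_memLp hp hK hσ)
      ((K.transport p hp hK n).symm u) = (K.transport p hp hK n).symm (integralOperator σ hσ u) := by
  obtain ⟨Ψ, hΨ, hcod, hgood⟩ := K.exists_measurePreserving_phiInv p hp hK
  rw [K.transport_symm_eq hp hK hΨ hcod, K.transport_symm_eq hp hK hΨ hcod,
    ← integralOperator_compMeasurePreserving hΨ hσ,
    integralOperator_congr_ae _ _ (K.liftKernel_ae_eq hgood σ)]

/-! ### Step functions and the Galerkin compression. -/

namespace SelfSimilarSet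

open scoped InnerProductSpace

variable {k : ℕ} {Y : Type*} [MetricSpace Y] [MeasurableSpace Y] [BorelSpace Y]
  (K : SelfSimilarSet k Y) {p : PMF (Fin k)} {n m : ℕ}

theorem cellIndicator_coeFn (w : Word k m) (c : Vec n) :
    K.cellIndicator p w c =ᵐ[K.measure p] (K.cell w).indicator fun _ => c :=
  indicatorConstLp_coeFn

theorem cellIndicator_add (w : Word k m) (c c' : Vec n) :
    K.cellIndicator p w (c + c') = K.cellIndicator p w c + K.cellIndicator p w c' :=
  indicatorConstLp_add.symm

theorem cellIndicator_smul (w : Word k m) (a : ℝ) (c : Vec n) :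
    K.cellIndicator p w (a • c) = a • K.cellIndicator p w c := by
  rw [cellIndicator, cellIndicator, indicatorConstLp, indicatorConstLp, ← MemLp.toLp_const_smul,
    MemLp.toLp_eq_toLp_iff]
  exact Eventually.of_forall fun x => indicator_const_smul_apply ..

/-- The map `c ↦ 1_{K_w} c`. -/
noncomputable def cellIndicatorLinear (p : PMF (Fin k)) (w : Word k m) : Vec n →ₗ[ℝ] L2 (K.measure p) n where
  toFun := K.cellIndicator p w
  map_add' := K.cellIndicator_add w
  map_smul' := K.cellIndicator_smul w

/-- The map `c ↦ ∑_w c_w 1_{K_w}`. -/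
noncomputable def stepFunctionL (p : PMF (Fin k)) (m n : ℕ) : (Word k m → Vec n) →L[ℝ] L2 (K.measure p) n :=
  LinearMap.toContinuousLinearMap
    (∑ w, (K.cellIndicatorLinear p w).comp (LinearMap.proj w))

theorem stepFunctionL_apply (c : Word k m → Vec n) :
    K.stepFunctionL p m n c = K.stepFunction p c := by
  simp [stepFunctionL, stepFunction, cellIndicatorLinear]

theorem cellIndicator_eq_sum (w : Word k m) (c : Vec n) :
    K.cellIndicator p w c =
      ∑ j, c j • K.cellIndicator p w (EuclideanSpace.single j (1 : ℝ)) := by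
  have h : c = ∑ j, c j • EuclideanSpace.single j (1 : ℝ) := by
    simpa using ((EuclideanSpace.basisFun (Fin n) ℝ).sum_repr c).symm
  change K.cellIndicatorLinear p w c = _
  conv_lhs => rw [h]
  rw [map_sum]
  exact Finset.sum_congr rfl fun j _ => map_smul ..

theorem cellIndicator_mem_stepSpace (w : Word k m) (c : Vec n) :
    K.cellIndicator p w c ∈ K.stepSpace p m n := by
  rw [cellIndicator_eq_sum]
  exact Submodule.sum_mem _ fun j _ => Submodule.smul_mem _ _ (Submodule.subset_span ⟨(w, j), rfl⟩)

theorem stepFunction_mem_stepSpace (c : Word k m → Vec n) :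
    K.stepFunction p c ∈ K.stepSpace p m n :=
  Submodule.sum_mem _ fun w _ => K.cellIndicator_mem_stepSpace w (c w)

theorem stepFunction_coeFn (c : Word k m → Vec n) :
    K.stepFunction p c =ᵐ[K.measure p] fun x => ∑ w, (K.cell w).indicator (fun _ => c w) x := by
  have h : ∀ᵐ x ∂K.measure p, ∀ w ∈ Finset.univ, K.cellIndicator p w (c w) x =
      (K.cell w).indicator (fun _ => c w) x :=
    (Finset.eventually_all _).2 fun w _ => K.cellIndicator_coeFn w (c w)
  filter_upwards [h, Lp.coeFn_finsetSum Finset.univ fun w => K.cellIndicator p w (c w)] with x hx hs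
  rw [stepFunction, hs, Finset.sum_apply]
  exact Finset.sum_congr rfl hx

theorem stepFunction_single (w : Word k m) (c : Vec n) :
    K.stepFunction p (Pi.single w c) = K.cellIndicator p w c := by
  rw [stepFunction, Finset.sum_eq_single w]
  · rw [Pi.single_eq_same]
  · intro v _ hv
    rw [Pi.single_eq_of_ne hv]
    exact map_zero (K.cellIndicatorLinear p v)
  · simp

/-- Cells of the same level may intersect, but only in null sets, so the other coefficients do not
contribute. -/
theorem setIntegral_stepFunction [NeZero k] (hK : bernoulliMeasure p K.ambiguous = 0)
    (c : Word k m → Vec n) (v : Word k m) :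
    ∫ x in K.cell v, K.stepFunction p c x ∂K.measure p = (K.measure p).real (K.cell v) • c v := by
  rw [integral_congr_ae (ae_restrict_of_ae (K.stepFunction_coeFn c)), integral_finsetSum]
  · rw [Finset.sum_eq_single v]
    · rw [setIntegral_indicator (K.measurableSet_cell v), inter_self, setIntegral_const]
    · intro w _ hw
      rw [setIntegral_indicator (K.measurableSet_cell w), setIntegral_const, measureReal_def,
        K.measure_cell_inter_cell hK hw.symm, ENNReal.toReal_zero, zero_smul]
    · simp
  · exact fun w _ => (integrable_const _).indicator (K.measurableSet_cell w)

/-- P_m is self-adjoint and fixes 1_{K_v} c, so pairing with these indicators does not see the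
projection. Consequently an operator that reads only cell integrals factors through P_m. -/
theorem setIntegral_stepProj (u : L2 (K.measure p) n) (v : Word k m) :
    ∫ x in K.cell v, K.stepProj p m u x ∂K.measure p = ∫ x in K.cell v, u x ∂K.measure p := by
  refine ext_inner_left ℝ fun c => ?_
  rw [← L2.inner_indicatorConstLp_eq_inner_setIntegral ℝ (K.measurableSet_cell v)
    (measure_ne_top _ _), ← L2.inner_indicatorConstLp_eq_inner_setIntegral ℝ
    (K.measurableSet_cell v) (measure_ne_top _ _)]
  change ⟪K.cellIndicator p v c, (K.stepSpace p m n).starProjection u⟫_ℝ = _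
  rw [← Submodule.inner_starProjection_left_eq_right,
    Submodule.starProjection_eq_self_iff.2 (K.cellIndicator_mem_stepSpace v c)]
  rfl

theorem stepKernel_memLp {F : Type*} [NormedAddCommGroup F] [NormedSpace ℝ F] (κ : Y × Y → F)
    (m : ℕ) : MemLp (K.stepKernel p κ m) 2 ((K.measure p).prod (K.measure p)) := by
  unfold stepKernel
  refine memLp_finsetSum _ fun w _ => memLp_finsetSum _ fun v _ => ?_
  exact (memLp_const _).indicator ((K.measurableSet_cell w).prod (K.measurableSet_cell v))

variable (κ : Y × Y → (Vec n →L[ℝ] Vec n))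

/-- The step-kernel operator in terms of the cell averages. -/
theorem integralOperator_stepKernel (m : ℕ) (u : L2 (K.measure p) n) :
    integralOperator (K.stepKernel p κ m) (K.stepKernel_memLp κ m) u =
      K.stepFunction p fun w => ∑ v : Word k m,
        K.cellAverage p κ w v (∫ y in K.cell v, u y ∂K.measure p) := by
  refine Lp.ext ?_
  filter_upwards [integralOperator_coeFn _ (K.stepKernel_memLp κ m) u, K.stepFunction_coeFn
    fun w => ∑ v : Word k m, K.cellAverage p κ w v (∫ y in K.cell v, u y ∂K.measure p)]
    with x h1 h2
  have hu : Integrable u (K.measure p) := (Lp.memLp u).integrable one_le_two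
  have hpt : ∀ y, K.stepKernel p κ m (x, y) (u y) = ∑ w : Word k m, ∑ v : Word k m,
      (K.cell w).indicator (fun _ =>
        (K.cell v).indicator (fun y => K.cellAverage p κ w v (u y)) y) x := by
    intro y
    simp only [stepKernel, sum_apply]
    refine Finset.sum_congr rfl fun w _ => Finset.sum_congr rfl fun v _ => ?_
    by_cases hx : x ∈ K.cell w <;> by_cases hy : y ∈ K.cell v <;> simp [hx, hy]
  have hint : ∀ w v : Word k m, Integrable (fun y => (K.cell w).indicator (fun _ =>
      (K.cell v).indicator (fun y => K.cellAverage p κ w v (u y)) y) x) (K.measure p) := by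
    intro w v
    by_cases hx : x ∈ K.cell w
    · simpa [hx] using ((K.cellAverage p κ w v).integrable_comp hu).indicator
        (K.measurableSet_cell v)
    · simp [hx]
  rw [h1, h2]
  simp only [hpt]
  rw [integral_finsetSum _ fun w _ => integrable_finsetSum _ fun v _ => hint w v]
  refine Finset.sum_congr rfl fun w _ => ?_
  rw [integral_finsetSum _ fun v _ => hint w v]
  by_cases hx : x ∈ K.cell w
  · simp only [indicator_of_mem hx]
    refine Finset.sum_congr rfl fun v _ => ?_
    rw [integral_indicator (K.measurableSet_cell v),
      (K.cellAverage p κ w v).integral_comp_comm hu.integrableOn]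
  · simp [hx]

/-- By Fubini, these are the matrix entries of the integral operator between cell indicators, to be
compared with those of the step kernel. -/
theorem setIntegral_integralOperator_cellIndicator
    (hκ : MemLp κ 2 ((K.measure p).prod (K.measure p)))
    (w v : Word k m) (c : Vec n) :
    ∫ x in K.cell w, integralOperator κ hκ (K.cellIndicator p v c) x ∂K.measure p =
      (∫ z in K.cell w ×ˢ K.cell v, κ z ∂(K.measure p).prod (K.measure p)) c := by
  have hint := hκ.integrable one_le_two
  rw [ContinuousLinearMap.integral_apply hint.integrableOn, setIntegral_prod]
  · refine integral_congr_ae (ae_restrict_of_ae ?_)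
    filter_upwards [integralOperator_coeFn κ hκ (K.cellIndicator p v c)] with x hx
    rw [hx, ← integral_indicator (K.measurableSet_cell v)]
    refine integral_congr_ae ?_
    filter_upwards [K.cellIndicator_coeFn v c] with y hy
    rw [hy]
    by_cases h : y ∈ K.cell v <;> simp [h]
  · exact (hint.apply_continuousLinearMap c).integrableOn

/-- The factors ν(K_w) and ν(K_v) cancel the normalisation of the cell average, which leaves the
same matrix entry as for κ. -/
theorem setIntegral_integralOperator_stepKernel_cellIndicator [NeZero k]
    (hK : bernoulliMeasure p K.ambiguous = 0) (w v : Word k m) (c : Vec n) :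
    ∫ x in K.cell w, integralOperator (K.stepKernel p κ m) (K.stepKernel_memLp κ m)
      (K.cellIndicator p v c) x ∂K.measure p =
      (∫ z in K.cell w ×ˢ K.cell v, κ z ∂(K.measure p).prod (K.measure p)) c := by
  rw [integralOperator_stepKernel, K.setIntegral_stepFunction hK, ← K.stepFunction_single,
    Finset.sum_eq_single v]
  · rw [K.setIntegral_stepFunction hK, Pi.single_eq_same, map_smul, smul_smul,
      ← measureReal_prod_prod, ← smul_apply, cellAverage,
      measure_smul_setAverage _ (measure_ne_top _ _)]
  · intro v' _ hv'
    rw [K.setIntegral_stepFunction hK, Pi.single_eq_of_ne hv', smul_zero, map_zero]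
  · simp

/-- On step functions, the step-kernel operator is the compression of the integral operator. -/
theorem inner_integralOperator_stepKernel_of_mem [NeZero k]
    (hK : bernoulliMeasure p K.ambiguous = 0) (hκ : MemLp κ 2 ((K.measure p).prod (K.measure p)))
    {u v : L2 (K.measure p) n} (hu : u ∈ K.stepSpace p m n) (hv : v ∈ K.stepSpace p m n) :
    ⟪v, integralOperator (K.stepKernel p κ m) (K.stepKernel_memLp κ m) u⟫_ℝ =
      ⟪v, integralOperator κ hκ u⟫_ℝ := by
  induction hv using Submodule.span_induction with
  | zero => simp
  | add a b _ _ ha hb => rw [inner_add_left, inner_add_left, ha, hb]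
  | smul c a _ ha => rw [inner_smul_left, inner_smul_left, ha]
  | mem v hv =>
    obtain ⟨⟨w, i⟩, rfl⟩ := hv
    induction hu using Submodule.span_induction with
    | zero => simp
    | add a b _ _ ha hb => rw [map_add, map_add, inner_add_right, inner_add_right, ha, hb]
    | smul c a _ ha => rw [map_smul, map_smul, inner_smul_right, inner_smul_right, ha]
    | mem u hu =>
      obtain ⟨⟨v, j⟩, rfl⟩ := hu
      change ⟪indicatorConstLp 2 _ _ _, _⟫_ℝ = ⟪indicatorConstLp 2 _ _ _, _⟫_ℝ
      rw [L2.inner_indicatorConstLp_eq_inner_setIntegral, L2.inner_indicatorConstLp_eq_inner_setIntegral,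
        K.setIntegral_integralOperator_stepKernel_cellIndicator κ hK,
        K.setIntegral_integralOperator_cellIndicator]

/-- The step-kernel operator is the Galerkin compression `P_m A P_m`. -/
theorem inner_integralOperator_stepKernel [NeZero k]
    (hK : bernoulliMeasure p K.ambiguous = 0) (hκ : MemLp κ 2 ((K.measure p).prod (K.measure p)))
    (u v : L2 (K.measure p) n) :
    ⟪v, integralOperator (K.stepKernel p κ m) (K.stepKernel_memLp κ m) u⟫_ℝ =
      ⟪K.stepProj p m v, integralOperator κ hκ (K.stepProj p m u)⟫_ℝ := by
  -- The step-kernel operator absorbs P_m on the right, since it depends on cell integrals only, and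
  -- on the left, since its values are step functions. This reduces the claim to the step space.
  have h1 : integralOperator (K.stepKernel p κ m) (K.stepKernel_memLp κ m) u =
      integralOperator (K.stepKernel p κ m) (K.stepKernel_memLp κ m) (K.stepProj p m u) := by
    simp only [integralOperator_stepKernel, setIntegral_stepProj]
  have h2 : K.stepProj p m (integralOperator (K.stepKernel p κ m) (K.stepKernel_memLp κ m) u) =
      integralOperator (K.stepKernel p κ m) (K.stepKernel_memLp κ m) u := by
    rw [integralOperator_stepKernel]
    exact Submodule.starProjection_eq_self_iff.2 (K.stepFunction_mem_stepSpace _)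
  rw [← K.inner_integralOperator_stepKernel_of_mem κ hK hκ
    (u := K.stepProj p m u) (v := K.stepProj p m v)
    (Submodule.starProjection_apply_mem _ _) (Submodule.starProjection_apply_mem _ _), ← h1]
  nth_rw 1 [← h2]
  exact (Submodule.inner_starProjection_left_eq_right ..).symm

theorem norm_stepProj_le (u : L2 (K.measure p) n) : ‖K.stepProj p m u‖ ≤ ‖u‖ :=
  Submodule.norm_starProjection_apply_le _ _

/-- Compression by an orthogonal projector does not increase the norm: test the quadratic identity
against the image of u itself. -/
theorem norm_integralOperator_stepKernel_le [NeZero k]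
    (hK : bernoulliMeasure p K.ambiguous = 0) (hκ : MemLp κ 2 ((K.measure p).prod (K.measure p))) :
    ‖integralOperator (K.stepKernel p κ m) (K.stepKernel_memLp κ m)‖ ≤
      ‖integralOperator κ hκ‖ := by
  refine ContinuousLinearMap.opNorm_le_bound _ (norm_nonneg _) fun u => ?_
  set x := integralOperator (K.stepKernel p κ m) (K.stepKernel_memLp κ m) u with hx
  have h : ‖x‖ * ‖x‖ ≤ ‖x‖ * (‖integralOperator κ hκ‖ * ‖u‖) := by
    rw [← real_inner_self_eq_norm_mul_norm]
    nth_rw 2 [hx]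
    rw [K.inner_integralOperator_stepKernel κ hK hκ]
    refine (real_inner_le_norm _ _).trans (mul_le_mul (K.norm_stepProj_le _) ?_ (norm_nonneg _)
      (norm_nonneg _))
    exact (ContinuousLinearMap.le_opNorm _ _).trans
      (mul_le_mul_of_nonneg_left (K.norm_stepProj_le _) (norm_nonneg _))
  rcases (norm_nonneg x).eq_or_lt with h0 | h0
  · rw [← h0]; positivity
  · exact le_of_mul_le_mul_left h h0

end SelfSimilarSet

/-! ### Uniform stability of the Galerkin semigroups. -/

open scoped InnerProductSpace

/-- The given semigroup S_ε has a bounded generator, hence is its exponential; the stability bound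
can thus be used for `NormedSpace.exp`. -/
theorem StabilityConsistency.norm_exp_smul_apply_le {H : Type*} [NormedAddCommGroup H]
    [NormedSpace ℝ H] [CompleteSpace H] {X : Type*} [NormedAddCommGroup X]
    [NormedSpace ℝ X] {A : H →ₗ.[ℝ] H} {Aε : ∀ ε : ℝ, 0 < ε → (H →L[ℝ] H)} {ι : X →L[ℝ] H}
    {D₀ : Submodule ℝ X} {r : ℝ → ℝ} {M ω : ℝ} (h : StabilityConsistency A Aε ι D₀ r M ω) {ε : ℝ}
    (hε : 0 < ε) {t : ℝ} (ht : 0 ≤ t) (x : H) :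
    ‖NormedSpace.exp (t • Aε ε hε) x‖ ≤ M * Real.exp (ω * t) * ‖x‖ := by
  obtain ⟨Sε, hgen, hbd⟩ := h.stability ε hε
  rw [← hgen.op_eq_exp ht]
  exact ((Sε.op t).le_opNorm x).trans (mul_le_mul_of_nonneg_right (hbd t ht) (norm_nonneg x))

/-- Exponential bounds are stable under bounded perturbations and conjugation. -/
theorem norm_exp_smul_apply_le_of_conj {H H' : Type*} [NormedAddCommGroup H] [NormedSpace ℝ H]
    [CompleteSpace H] [NormedAddCommGroup H'] [NormedSpace ℝ H'] [CompleteSpace H']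
    (e : H ≃ₗᵢ[ℝ] H') {G : H →L[ℝ] H} {G' : H' →L[ℝ] H'} {N T a : ℝ} (hN : 0 ≤ N) (ha : 0 ≤ a)
    (hG' : ∀ t ∈ Icc 0 T, ∀ x, ‖NormedSpace.exp (t • G') x‖ ≤ N * ‖x‖)
    (h : ∀ x, ‖e (G x) - G' (e x)‖ ≤ a * ‖x‖) {t : ℝ} (ht : t ∈ Icc 0 T) (x : H) :
    ‖NormedSpace.exp (t • G) x‖ ≤ N * Real.exp (N * a * T) * ‖x‖ := by
  have hd : ∀ s : ℝ, HasDerivAt (fun s : ℝ => e (NormedSpace.exp (s • G) x))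
      (e (G (NormedSpace.exp (s • G) x))) s := fun s =>
    (e : H →L[ℝ] H').hasFDerivAt.comp_hasDerivAt s (hasDerivAt_exp_smul_apply G x s)
  -- The transported orbit e(exp(sG)x) solves v' = G'v + f with ‖f‖ ≤ a ‖v‖, so the estimate applies
  -- with b = 0.
  have := norm_le_of_perturbed_evolution G' hN ha le_rfl hG'
    (fun s _ => (hd s).continuousAt.continuousWithinAt) (fun s _ => (hd s).hasDerivWithinAt)
    (fun s _ => by
      rw [e.norm_map, add_zero]
      exact h _) t ht
  simp only [e.norm_map, zero_smul, NormedSpace.exp_zero, one_apply_eq_self, zero_mul,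
    add_zero] at this
  linarith

namespace SelfSimilarSet

variable {k : ℕ} [k.AtLeastTwo] {Y : Type*} [MetricSpace Y] [MeasurableSpace Y] [BorelSpace Y]
  (K : SelfSimilarSet k Y) {p : PMF (Fin k)} {n : ℕ}

/-- Stability of the Galerkin system: it is inherited from the nonlocal operator if that operator
generates a quasi-contractive semigroup, and follows from a bound for the kernel or for the
discretization error otherwise. -/
theorem exists_bound_exp_stepKernel (hp : ∀ i, p i ≠ 0) (hK : bernoulliMeasure p K.ambiguous = 0)
    {A : L2 (unitMeasure p) n →ₗ.[ℝ] L2 (unitMeasure p) n}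
    {σ : ℝ → ℝ × ℝ → (Vec n →L[ℝ] Vec n)}
    (hσ : ∀ ε, 0 < ε → MemLp (σ ε) 2 ((unitMeasure p).prod (unitMeasure p)))
    {X : Type*} [NormedAddCommGroup X] [NormedSpace ℝ X] {ι : X →L[ℝ] L2 (unitMeasure p) n}
    {D₀ : Submodule ℝ X} {r : ℝ → ℝ} {M ω : ℝ}
    (hA : StabilityConsistency A (fun ε hε => integralOperator (σ ε) (hσ ε hε)) ι D₀ r M ω)
    (T D : ℝ) :
    ∃ N : ℝ, 0 ≤ N ∧ ∀ ε, 0 < ε → ∀ m : ℕ,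
      (M = 1 ∨ K.kernelNorm p (K.liftKernel (σ ε)) ≤ D ∨
        K.kernelNorm p (K.liftKernel (σ ε) - K.stepKernel p (K.liftKernel (σ ε)) m) ≤ D) →
      ∀ t ∈ Icc 0 T, ∀ x, ‖NormedSpace.exp (t • integralOperator
        (K.stepKernel p (K.liftKernel (σ ε)) m) (K.stepKernel_memLp _ m)) x‖ ≤ N * ‖x‖ := by
  have hM : 0 ≤ M := zero_le_one.trans hA.one_le
  -- One constant per alternative: quasi-contractive, bounded kernel, bounded discretization error.
  -- Their sum serves all three.
  set N₁ := Real.exp (|ω| * T)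
  set N₂ := Real.exp (|D| * T)
  set N₃ := M * N₁ * Real.exp (M * N₁ * |D| * T)
  have hN₁ : 0 ≤ N₁ := (Real.exp_pos _).le
  have hN₂ : 0 ≤ N₂ := (Real.exp_pos _).le
  have hN₃ : 0 ≤ N₃ := by positivity
  refine ⟨N₁ + N₂ + N₃, by positivity, fun ε hε m hcase t ht x => ?_⟩
  have hκ := K.liftKernel_memLp hp hK (hσ ε hε)
  rcases hcase with rfl | hD | hD
  -- With M = 1 the bound on S_ε is equivalent to a bound on the quadratic form of A_ε; the latter
  -- passes to K by unitary conjugation and to G because P_m is a contraction.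
  · have hdiss : ∀ u, ⟪u, integralOperator (σ ε) (hσ ε hε) u⟫_ℝ ≤ |ω| * ‖u‖ ^ 2 := fun u =>
      (inner_le_of_norm_exp_le fun s hs => by
        simpa using hA.norm_exp_smul_apply_le hε hs u).trans
        (mul_le_mul_of_nonneg_right (le_abs_self ω) (sq_nonneg _))
    have hG : ∀ x, ⟪x, integralOperator (K.stepKernel p (K.liftKernel (σ ε)) m)
        (K.stepKernel_memLp _ m) x⟫_ℝ ≤ |ω| * ‖x‖ ^ 2 := by
      intro x
      rw [K.inner_integralOperator_stepKernel _ hK hκ]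
      obtain ⟨u, hu⟩ := (K.transport p hp hK n).symm.surjective (K.stepProj p m x)
      rw [← hu, K.integralOperator_liftKernel hp hK (hσ ε hε), LinearIsometryEquiv.inner_map_map]
      refine (hdiss u).trans (mul_le_mul_of_nonneg_left ?_ (abs_nonneg ω))
      rw [← (K.transport p hp hK n).symm.norm_map u, hu]
      exact pow_le_pow_left₀ (norm_nonneg _) (K.norm_stepProj_le x) 2
    refine (norm_exp_smul_apply_le_of_inner_le hG ht.1 x).trans
      (mul_le_mul_of_nonneg_right ?_ (norm_nonneg x))
    have : Real.exp (|ω| * t) ≤ N₁ :=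
      Real.exp_le_exp.2 (mul_le_mul_of_nonneg_left ht.2 (abs_nonneg ω))
    linarith
  · have hnorm : ‖integralOperator (K.stepKernel p (K.liftKernel (σ ε)) m)
        (K.stepKernel_memLp _ m)‖ ≤ |D| :=
      (K.norm_integralOperator_stepKernel_le _ hK hκ).trans
        ((norm_integralOperator_le hκ).trans (hD.trans (le_abs_self D)))
    refine (norm_exp_smul_apply_le _ hnorm ht.1 x).trans
      (mul_le_mul_of_nonneg_right ?_ (norm_nonneg x))
    have : Real.exp (|D| * t) ≤ N₂ :=
      Real.exp_le_exp.2 (mul_le_mul_of_nonneg_left ht.2 (abs_nonneg D))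
    linarith
  -- Transported to Q, G differs from A_ε by an operator of norm at most δ ≤ |D|, so the stability
  -- of S_ε survives for any M.
  · refine (norm_exp_smul_apply_le_of_conj (K.transport p hp hK n)
      (G' := integralOperator (σ ε) (hσ ε hε)) (N := M * N₁) (T := T) (a := |D|) (by positivity)
      (abs_nonneg D) (fun s hs y => ?_) (fun y => ?_) ht x).trans
      (mul_le_mul_of_nonneg_right (by linarith) (norm_nonneg x))
    · refine (hA.norm_exp_smul_apply_le hε hs.1 y).trans
        (mul_le_mul_of_nonneg_right (mul_le_mul_of_nonneg_left (Real.exp_le_exp.2 ?_) hM)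
          (norm_nonneg y))
      exact (mul_le_mul_of_nonneg_right (le_abs_self ω) hs.1).trans
        (mul_le_mul_of_nonneg_left hs.2 (abs_nonneg ω))
    · have h1 := K.integralOperator_liftKernel hp hK (hσ ε hε) (K.transport p hp hK n y)
      rw [LinearIsometryEquiv.symm_apply_apply] at h1
      rw [← (K.transport p hp hK n).symm.norm_map, map_sub, LinearIsometryEquiv.symm_apply_apply,
        ← h1, norm_sub_rev, ← sub_apply, ← integralOperator_sub hκ (K.stepKernel_memLp _ m)]
      exact (ContinuousLinearMap.le_opNorm _ _).trans (mul_le_mul_of_nonneg_right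
        ((norm_integralOperator_le _).trans (hD.trans (le_abs_self D))) (norm_nonneg y))

/-- The particle system is the evolution equation of the step-kernel operator. -/
theorem IsParticleSolution.hasDerivWithinAt (hK : bernoulliMeasure p K.ambiguous = 0)
    {κ : Y × Y → (Vec n →L[ℝ] Vec n)} {m : ℕ} {T : ℝ} {u₀ : L2 (K.measure p) n}
    {U : ℝ → Word k m → Vec n} (hU : K.IsParticleSolution p κ m T u₀ U) {t : ℝ}
    (ht : t ∈ Icc 0 T) :
    HasDerivWithinAt (fun s => K.stepFunction p (U s))
      (integralOperator (K.stepKernel p κ m) (K.stepKernel_memLp κ m) (K.stepFunction p (U t)))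
      (Icc 0 T) t := by
  have h := (K.stepFunctionL p m n).hasFDerivAt.comp_hasDerivWithinAt t
    (hasDerivWithinAt_pi.2 fun w => hU.ode t ht w)
  rw [stepFunctionL_apply] at h
  refine (h.congr_of_mem (fun s _ => (K.stepFunctionL_apply (U s)).symm) ht).congr_deriv ?_
  rw [integralOperator_stepKernel]
  simp only [K.setIntegral_stepFunction hK, map_smul]

end SelfSimilarSet

end FractalLift

/-! ### The error estimate. -/

theorem mainTheorem1 {k : ℕ} [k.AtLeastTwo] {d n : ℕ}
    -- the self-similar set, the probability vector, the standing assumption on the coding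
    (K : SelfSimilarSet k (EuclideanSpace ℝ (Fin d)))
    (p : PMF (Fin k)) (hp : ∀ i, p i ≠ 0) (hK : bernoulliMeasure p K.ambiguous = 0)
    -- the reference evolution on the unit interval
    (A : L2 (unitMeasure p) n →ₗ.[ℝ] L2 (unitMeasure p) n)
    (S : C0Semigroup (L2 (unitMeasure p) n)) (hS : S.HasGenerator A)
    -- the nonlocal kernels, the regularity space, and the stability and consistency assumption
    (σ : ℝ → ℝ × ℝ → (Vec n →L[ℝ] Vec n))
    (hσ : ∀ ε, 0 < ε → MemLp (σ ε) 2 ((unitMeasure p).prod (unitMeasure p)))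
    {X : Type*} [NormedAddCommGroup X] [NormedSpace ℝ X] [CompleteSpace X]
    (ι : X →L[ℝ] L2 (unitMeasure p) n) (hι : IsRegularitySpace A ι)
    (D₀ : Submodule ℝ X) (r : ℝ → ℝ) (M ω : ℝ)
    (hA : StabilityConsistency A (fun ε hε => integralOperator (σ ε) (hσ ε hε)) ι D₀ r M ω)
    (T : ℝ) (hT : 0 < T) (B R D : ℝ) :
    ∃ C : ℝ, ∀ u₀ : X, ‖ι u₀‖ ≤ R → StaysRegular S ι T B u₀ →
      ∀ ε, 0 < ε → ∀ m : ℕ,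
        (M = 1 ∨ K.kernelNorm p (K.liftKernel (σ ε)) ≤ D ∨
          K.kernelNorm p
            (K.liftKernel (σ ε) - K.stepKernel p (K.liftKernel (σ ε)) m) ≤ D) →
        ∀ U : ℝ → Word k m → Vec n,
          K.IsParticleSolution p (K.liftKernel (σ ε)) m T
            ((K.transport p hp hK n).symm (ι u₀)) U →
          ContinuousOn (fun t => K.stepFunction p (U t) -
            (K.transport p hp hK n).symm (S.op t (ι u₀))) (Set.Icc 0 T) ∧
          ∀ t ∈ Set.Icc 0 T,
            ‖K.stepFunction p (U t) - (K.transport p hp hK n).symm (S.op t (ι u₀))‖ ≤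
              C * (r ε * ‖u₀‖ +
                ‖(K.transport p hp hK n).symm (ι u₀) -
                  K.stepProj p m ((K.transport p hp hK n).symm (ι u₀))‖ +
                K.kernelNorm p
                  (K.liftKernel (σ ε) - K.stepKernel p (K.liftKernel (σ ε)) m)) := by
  obtain ⟨CS, hCS1, hCS⟩ := S.exists_bound T
  obtain ⟨N, hN, hexp⟩ := K.exists_bound_exp_stepKernel hp hK hσ hA T D
  have hCS0 : 0 ≤ CS := zero_le_one.trans hCS1
  -- N bounds exp(tG), CS |R| bounds ‖u(t)‖ and multiplies the kernel error, and |B| comes from the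
  -- bound on ‖u(t)‖_X; T is the length of the Duhamel integral.
  refine ⟨N * (1 + T * (CS * |R| + |B|)), fun u₀ hR hreg ε hε m hcase U hU => ?_⟩
  have hκ := K.liftKernel_memLp hp hK (hσ ε hε)
  set κ := K.liftKernel (σ ε)
  set τ := (K.transport p hp hK n).symm
  set G := integralOperator (K.stepKernel p κ m) (K.stepKernel_memLp κ m)
  set δ := K.kernelNorm p (κ - K.stepKernel p κ m)
  have hδ : 0 ≤ δ := ENNReal.toReal_nonneg
  set y₀ := A ⟨ι u₀, hι.mem_domain u₀⟩
  have hy₀ : (ι u₀, y₀) ∈ A.graph := LinearPMap.mem_graph A ⟨ι u₀, hι.mem_domain u₀⟩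
  -- No sign is prescribed for r ε; consistency at u⁰ itself forces this product to be nonnegative.
  have hρ : 0 ≤ r ε * ‖u₀‖ := (norm_nonneg _).trans (hA.norm_sub_le hS hι hε u₀ hy₀)
  have hrate : ∀ φ : X, ‖φ‖ ≤ B * ‖u₀‖ → r ε * ‖φ‖ ≤ |B| * (r ε * ‖u₀‖) := by
    intro φ hφ
    have hφ' : ‖φ‖ ≤ |B| * ‖u₀‖ :=
      hφ.trans (mul_le_mul_of_nonneg_right (le_abs_self B) (norm_nonneg _))
    rcases le_or_gt 0 (r ε) with h | h
    · exact (mul_le_mul_of_nonneg_left hφ' h).trans_eq (mul_left_comm _ _ _)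
    · exact (mul_nonpos_of_nonpos_of_nonneg h.le (norm_nonneg _)).trans
        (mul_nonneg (abs_nonneg B) hρ)
  have hcontU : ContinuousOn (fun t => K.stepFunction p (U t)) (Icc 0 T) := fun t ht =>
    (hU.hasDerivWithinAt K hK ht).continuousWithinAt
  have hcont : ContinuousOn (fun t => K.stepFunction p (U t) - τ (S.op t (ι u₀))) (Icc 0 T) :=
    hcontU.sub (τ.continuous.comp_continuousOn
      ((S.continuousOn_orbit _).mono Icc_subset_Ici_self))
  refine ⟨hcont, fun t ht => ?_⟩
  -- The residual e' - G e does not involve e, so a = 0 and no Grönwall factor appears.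
  have hmain := norm_le_of_perturbed_evolution G (T := T) (a := 0)
    (b := δ * (CS * |R|) + |B| * (r ε * ‖u₀‖)) hN le_rfl (by positivity)
    (hexp ε hε m hcase) hcont
    (e' := fun t => G (K.stepFunction p (U t)) - τ (S.op t y₀))
    (fun t ht => by
      refine HasDerivWithinAt.sub ?_ ?_
      · exact (hU.hasDerivWithinAt K hK ⟨ht.1, ht.2.le⟩).mono_of_mem_nhdsWithin
          (Icc_mem_nhdsGE_of_mem ht)
      · exact (τ : L2 (unitMeasure p) n →L[ℝ] L2 (K.measure p) n).hasFDerivAt.comp_hasDerivWithinAt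
          t (hS.hasDerivWithinAt hy₀ ht.1))
    (fun t ht => by
      have ht' : t ∈ Icc 0 T := ⟨ht.1, ht.2.le⟩
      -- Boundedness in X is what allows consistency to be used along the trajectory, with A u(t) =
      -- S(t) A u⁰.
      obtain ⟨φ, hφ, hφB⟩ := hreg t ht'
      have hcons := hA.norm_sub_le hS hι hε φ (y := S.op t y₀)
        (by rw [hφ]; exact hS.op_mem_graph hy₀ ht.1)
      rw [hφ] at hcons
      -- The particle solution cancels; adding and subtracting Ã τu = τ A_ε u splits the residual
      -- into discretization and consistency errors.
      have hdecomp : G (K.stepFunction p (U t)) - τ (S.op t y₀) -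
          G (K.stepFunction p (U t) - τ (S.op t (ι u₀))) =
          -(integralOperator (κ - K.stepKernel p κ m) (hκ.sub (K.stepKernel_memLp κ m))
            (τ (S.op t (ι u₀)))) +
          τ (integralOperator (σ ε) (hσ ε hε) (S.op t (ι u₀)) - S.op t y₀) := by
        rw [integralOperator_sub hκ (K.stepKernel_memLp κ m), sub_apply,
          K.integralOperator_liftKernel hp hK (hσ ε hε), map_sub, map_sub]
        abel
      rw [hdecomp, zero_mul, zero_add]
      refine (norm_add_le _ _).trans (add_le_add ?_ ?_)
      · rw [norm_neg]
        refine (ContinuousLinearMap.le_opNorm _ _).trans (mul_le_mul (norm_integralOperator_le _)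
          ?_ (norm_nonneg _) hδ)
        rw [τ.norm_map]
        exact ((S.op t).le_opNorm _).trans
          (mul_le_mul (hCS t ht') (hR.trans (le_abs_self R)) (norm_nonneg _) hCS0)
      · rw [τ.norm_map]
        exact hcons.trans (hrate φ hφB))
    t ht
  refine hmain.trans ?_
  rw [hU.initial, S.op_zero_apply, norm_sub_rev, mul_zero, zero_mul, Real.exp_zero, mul_one,
    mul_assoc]
  refine mul_le_mul_of_nonneg_left ?_ hN
  set e₀ := ‖τ (ι u₀) - K.stepProj p m (τ (ι u₀))‖
  have he₀ : 0 ≤ e₀ := norm_nonneg _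
  -- These are exactly the products left over when the claimed right-hand side is expanded.
  have hrest : 0 ≤ r ε * ‖u₀‖ + δ + T * (CS * |R|) * (r ε * ‖u₀‖ + e₀) + T * |B| * (e₀ + δ) := by
    positivity
  linarith
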